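/- Let $d \ge 3$ and $1 \le p < \frac{2d}{d+2}$, and let $p' \in [1,\infty]$ be the conjugate exponent, $\frac1p+\frac1{p'}=1$. For $f \in L^1(\mathbb{R}^d)$ (complex valued) and a rotation $\rho \in SO(d)$ define the periodization $$g_\rho(x) = \sum_{\nu \in \mathbb{Z}^d} f(\rho(x-\nu)),$$ a series that converges absolutely for almost every $x \in \mathbb{R}^d$. Say that $f$ has identically vanishing periodizations if, for almost every $\rho \in SO(d)$ with respect to Haar measure, $g_\rho(x) = 0$ for almost every $x$. Let $\hat f(\xi) = \int_{\mathbb{R}^d} f(x) e^{-2\pi i x\cdot\xi}\,dx$. Then there is a constant $C < \infty$ depending only on $d$ and $p$ such that for every $f \in L^1(\mathbb{R}^d) \cap L^p(\mathbb{R}^d)$: (i) $f$ has identically vanishing periodizations if and only if for every $m \in \mathbb{Z}^d$ the function $\hat f$ vanishes on the sphere $\{\xi \in \mathbb{R}^d : |\xi| = |m|\}$, where $|m| = (m_1^2+\dots+m_d^2)^{1/2}$; (ii) if $f$ has identically vanishing periodizations, then $f \in L^{p'}(\mathbb{R}^d)$ and $\|f\|_{p'} \le C\|f\|_p$. -/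

import Mathlib

open MeasureTheory Matrix FourierTransform
open scoped ENNReal NNReal

/-- The rotation group `SO(d)`. It carries the topology of `d × d` real matrices. -/
abbrev SO (d : ℕ) : Type := Matrix.specialOrthogonalGroup (Fin d) ℝ

/-- The Borel sigma-algebra of `SO(d)`. -/
instance SO.instMeasurableSpace (d : ℕ) : MeasurableSpace (SO d) := borel (SO d)

instance SO.instBorelSpace (d : ℕ) : BorelSpace (SO d) := ⟨rfl⟩

theorem SO.continuous_inv (d : ℕ) : Continuous fun ρ : SO d => ρ⁻¹ := by
  refine Continuous.subtype_mk (f := fun ρ : SO d => (ρ : Matrix (Fin d) (Fin d) ℝ)ᵀ) ?_ _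
  exact continuous_subtype_val.matrix_transpose

instance SO.instIsTopologicalGroup (d : ℕ) : IsTopologicalGroup (SO d) where
  continuous_inv := SO.continuous_inv d

instance SO.instCompactSpace (d : ℕ) : CompactSpace (SO d) := by
  apply isCompact_iff_compactSpace.mp
  have hK : IsCompact (Set.univ.pi fun _ : Fin d => Set.univ.pi fun _ : Fin d =>
      Set.Icc (-1 : ℝ) 1) :=
    isCompact_univ_pi fun _ => isCompact_univ_pi fun _ => isCompact_Icc
  refine hK.of_isClosed_subset ?_ ?_
  · have : ((Matrix.specialOrthogonalGroup (Fin d) ℝ : Set (Matrix (Fin d) (Fin d) ℝ))) =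
        {A | A * Aᵀ = 1} ∩ {A | A.det = 1} := by
      ext A
      exact Matrix.mem_specialOrthogonalGroup_iff.trans
        (and_congr_left fun _ => Matrix.mem_orthogonalGroup_iff _ _)
    rw [this]
    exact (isClosed_eq (continuous_id.matrix_mul continuous_id.matrix_transpose)
      continuous_const).inter (isClosed_eq continuous_id.matrix_det continuous_const)
  · intro A hA i _ j _
    have h := entry_norm_bound_of_unitary (𝕜 := ℝ)
      (Matrix.mem_specialOrthogonalGroup_iff.1 hA).1 i j
    exact abs_le.1 h

/-- An integer vector, as a point of `ℝ^d`. -/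
noncomputable def latticePoint {d : ℕ} (ν : Fin d → ℤ) : EuclideanSpace ℝ (Fin d) :=
  WithLp.toLp 2 fun i => (ν i : ℝ)

/-- The periodization `g_ρ(x) = ∑_{ν ∈ ℤ^d} f (ρ (x - ν))`. For integrable `f` the series converges
absolutely for almost every `x`. -/
noncomputable def periodization {d : ℕ} (f : EuclideanSpace ℝ (Fin d) → ℂ) (ρ : SO d)
    (x : EuclideanSpace ℝ (Fin d)) : ℂ :=
  ∑' ν : Fin d → ℤ, f (Matrix.toEuclideanLin (ρ : Matrix (Fin d) (Fin d) ℝ) (x - latticePoint ν))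

/-- For almost every rotation `ρ` (with respect to Haar measure on `SO(d)`), the periodization
`g_ρ` is zero, as an (almost everywhere defined) integrable function. -/
def HasVanishingPeriodizations {d : ℕ} (f : EuclideanSpace ℝ (Fin d) → ℂ) : Prop :=
  ∀ᵐ ρ ∂(Measure.haar : Measure (SO d)), periodization f ρ =ᵐ[volume] 0

/-- The Fourier transform of `f` vanishes on each sphere centred at `0` of radius `|m|`, for
`m ∈ ℤ^d`. -/
def FourierVanishesOnLatticeSpheres {d : ℕ} (f : EuclideanSpace ℝ (Fin d) → ℂ) : Prop :=
  ∀ m : Fin d → ℤ, ∀ ξ ∈ Metric.sphere (0 : EuclideanSpace ℝ (Fin d)) ‖latticePoint m‖, 𝓕 f ξ = 0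

/-! Part (i) is Poisson summation. The Fourier coefficients of the periodization of `f ∘ ρ` are `𝓕 f
(ρ m)`, so `g_ρ` vanishes exactly when `𝓕 f` vanishes on `ρ(ℤ^d)`. Both `𝓕 f` and the action of `ρ`
are continuous and Haar measure charges open sets, so "almost every `ρ`" becomes "every `ρ`"; as
`SO(d)` is transitive on spheres, the orbit of `m` is the whole sphere of radius `|m|`.

Part (ii) applies Poisson summation again, in the variable `t = |ξ|²`. Every integer `8j + 3` is a
sum of three squares, so `𝓕 f = 0` on all spheres `|ξ|² = 8j + 3`. Multiply `𝓕 f` by `exp(-πε|ξ|² +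
2πi x·ξ)` and push forward to `t`: the density vanishes on the progression `8ℤ + 3`, hence the sum
over `k` of its Fourier transform at `k/8`, twisted by a character, is zero
(`tsum_gaussianConv_mul_fourier_eq_zero`). The `k`-th term is the flow of `f` with complex time `ε +
ik/4`. As `ε → 0` the term `k = 0` becomes `f` and the others become Schrödinger evolutions, so `f`
is minus their sum (`ae_eq_neg_schrodingerSum`).

The Schrödinger flow at time `s` is a chirp, a Fourier transform and a dilation. Hausdorff-Young
therefore bounds it from `L^p` to `L^{p'}` by `C |s|^{-d(1/p - 1/2)}`. Summability over `s = k/4`,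
`k ≠ 0`, means `d(1/p - 1/2) > 1`, which is `p < 2d/(d+2)`. -/

/-! ### Sums of three squares -/

/-- `m` is represented by a positive definite unimodular integral ternary quadratic form whose
leading principal minors are `a` and `A`. -/
def UnimodularTernaryRep (m a A : ℤ) : Prop :=
  ∃ b c d e f x y z : ℤ, a * b - d ^ 2 = A ∧
    a * b * c + 2 * d * e * f - a * f ^ 2 - b * e ^ 2 - c * d ^ 2 = 1 ∧
    a * x ^ 2 + b * y ^ 2 + c * z ^ 2 + 2 * d * x * y + 2 * e * x * z + 2 * f * y * z = m

theorem exists_abs_two_mul_sub_mul_le (B : ℤ) {A : ℤ} (hA : 0 < A) :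
    ∃ k : ℤ, |2 * (B - k * A)| ≤ A := by
  refine ⟨(2 * B + A) / (2 * A), ?_⟩
  have h1 := Int.emod_add_mul_ediv (2 * B + A) (2 * A)
  have h2 := Int.emod_nonneg (2 * B + A) (by omega : 2 * A ≠ 0)
  have h3 := Int.emod_lt_of_pos (2 * B + A) (by omega : 0 < 2 * A)
  rw [abs_le]
  constructor <;> nlinarith

theorem Int.exists_minimal_pos {P : ℤ → Prop} (h : ∃ a, 0 < a ∧ P a) :
    ∃ a, 0 < a ∧ P a ∧ ∀ b, 0 < b → P b → a ≤ b := by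
  obtain ⟨a, ha, h2⟩ := Int.exists_least_of_bdd (P := fun a => 0 < a ∧ P a)
    ⟨0, fun z hz => hz.1.le⟩ h
  exact ⟨a, ha.1, ha.2, fun b hb hPb => h2 b ⟨hb, hPb⟩⟩

/-- A positive definite unimodular integral ternary form represents only sums of three squares. -/
theorem UnimodularTernaryRep.exists_sum_three_squares {m a A : ℤ} (ha : 0 < a) (hA : 0 < A)
    (h : UnimodularTernaryRep m a A) : ∃ x y z : ℤ, x ^ 2 + y ^ 2 + z ^ 2 = m := by
  -- Gauss reduction: `a` is least among all such forms, then `A` is least for this `a`. Shears in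
  -- `x` and `y` preserve both minors; they are used to reduce `d` modulo `a` and the cofactor `a f
  -- - d e` modulo `A`.
  obtain ⟨a, ha, ⟨A', hA', hR'⟩, hamin⟩ := Int.exists_minimal_pos
    (P := fun a => ∃ A, 0 < A ∧ UnimodularTernaryRep m a A) ⟨a, ha, A, hA, h⟩
  obtain ⟨A, hA, hR, hAmin⟩ := Int.exists_minimal_pos
    (P := fun A => UnimodularTernaryRep m a A) ⟨A', hA', hR'⟩
  have h1 : ∃ b c d e f x y z : ℤ, a * b - d ^ 2 = A ∧
      a * b * c + 2 * d * e * f - a * f ^ 2 - b * e ^ 2 - c * d ^ 2 = 1 ∧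
      a * x ^ 2 + b * y ^ 2 + c * z ^ 2 + 2 * d * x * y + 2 * e * x * z + 2 * f * y * z = m ∧
      |2 * (a * f - d * e)| ≤ A ∧ |2 * d| ≤ a := by
    obtain ⟨b, c, d, e, f, x, y, z, hAe, hdet, hQ⟩ := hR
    obtain ⟨k, hk⟩ := exists_abs_two_mul_sub_mul_le (a * f - d * e) hA
    obtain ⟨l, hl⟩ := exists_abs_two_mul_sub_mul_le d ha
    refine ⟨b - 2 * l * d + l ^ 2 * a, c - 2 * k * f + k ^ 2 * b, d - l * a, e - k * d,
      (f - k * b) - l * (e - k * d), x + l * (y + k * z), y + k * z, z, ?_, ?_, ?_, ?_, hl⟩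
    · linear_combination hAe
    · linear_combination hdet
    · linear_combination hQ
    · rw [← hAe] at hk ⊢
      convert hk using 2
      ring
  obtain ⟨b, c, d, e, f, x, y, z, hAe, hdet, hQ, hB, hd⟩ := h1
  have hb : 0 < b := by nlinarith [sq_nonneg d]
  -- Exchanging `x` and `y` makes `b` the first minor and keeps `A`; below, exchanging `y` and `z`
  -- keeps `a` and turns `A` into `a c - e²`.
  have hab : a ≤ b := by
    refine hamin b hb ⟨A, hA, a, c, d, f, e, y, x, z, ?_, ?_, ?_⟩
    · linear_combination hAe
    · linear_combination hdet
    · linear_combination hQ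
  have hAC : A * (a * c - e ^ 2) - (a * f - d * e) ^ 2 = a := by
    rw [← hAe]
    linear_combination a * hdet
  have hC : 0 < a * c - e ^ 2 := by nlinarith [sq_nonneg (a * f - d * e)]
  have hACle : A ≤ a * c - e ^ 2 := by
    refine hAmin _ hC ⟨c, b, e, d, f, x, z, y, rfl, ?_, ?_⟩
    · linear_combination hdet
    · linear_combination hQ
  have hB2 : 4 * (a * f - d * e) ^ 2 ≤ A ^ 2 := by
    have := sq_le_sq' (abs_le.1 hB).1 (abs_le.1 hB).2
    linarith
  have hd2 : 4 * d ^ 2 ≤ a ^ 2 := by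
    have := sq_le_sq' (abs_le.1 hd).1 (abs_le.1 hd).2
    linarith
  -- `A² ≤ A (a c - e²) = a + (a f - d e)² ≤ a + A²/4`, and likewise `a² ≤ a b = A + d² ≤ A + a²/4`.
  -- The two inequalities force `a = A = 1`, after which completing the square in `x` finishes.
  have i1 : 3 * A ^ 2 ≤ 4 * a := by nlinarith
  have i2 : 3 * a ^ 2 ≤ 4 * A := by nlinarith
  have ha1 : a = 1 := by
    by_contra hne
    have h2 : 2 ≤ a := by omega
    have h3 : 3 ≤ A := by nlinarith
    rcases le_total a A with h | h <;> nlinarith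
  subst ha1
  have hA1 : A = 1 := by nlinarith
  have hd0 : d = 0 := by
    rw [abs_le] at hd; omega
  subst hd0
  have hb1 : b = 1 := by linarith
  subst hb1
  have hf0 : f = 0 := by
    rw [abs_le] at hB; omega
  subst hf0
  exact ⟨x + e * z, y, z, by linear_combination hQ - z ^ 2 * hdet⟩

/-- Modulo `b` one has `-2p ≡ 1`, and `-1`, `2` have Jacobi symbol `1` over `b`, so `(p/b) = 1`.
Reciprocity gives `(b/p) = 1`, and `-1` is a square modulo `p`. Jacobi symbols are needed because
`b` may be composite. -/
theorem legendreSym_neg_eq_one_of_two_mul_add_one_eq {m p b : ℕ} [Fact p.Prime]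
    (hp4 : p % 4 = 1) (hb8 : b % 8 = 1) (h : 2 * p + 1 = b * m) :
    legendreSym p (-(b : ℤ)) = 1 := by
  have hb4 : b % 4 = 1 := by omega
  have hbodd : Odd b := Nat.odd_iff.2 (by omega)
  have hpodd : Odd p := Nat.odd_iff.2 (by omega)
  have e2 : jacobiSym 2 b = 1 := by
    rw [jacobiSym.at_two hbodd, ZMod.χ₈_nat_mod_eight, hb8]; decide
  have em1 : jacobiSym (-1) b = 1 := by
    rw [jacobiSym.at_neg_one hbodd, ZMod.χ₄_nat_one_mod_four hb4]
  have em1' : jacobiSym (-1) p = 1 := by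
    rw [jacobiSym.at_neg_one hpodd, ZMod.χ₄_nat_one_mod_four hp4]
  have e : jacobiSym (p : ℤ) b = 1 := by
    have h1 : jacobiSym (-1 * (2 * (p : ℤ))) b = 1 := by
      rw [jacobiSym.mod_left]
      have : (-1 * (2 * (p : ℤ))) % (b : ℤ) = 1 % (b : ℤ) := by
        apply Int.ModEq.symm
        rw [Int.modEq_iff_dvd]
        refine ⟨-(m : ℤ), ?_⟩
        have : (2 * (p : ℤ) + 1) = b * m := by exact_mod_cast h
        linear_combination -this
      rw [this, ← jacobiSym.mod_left, jacobiSym.one_left]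
    rwa [jacobiSym.mul_left, jacobiSym.mul_left, em1, e2, one_mul, one_mul] at h1
  rw [jacobiSym.legendreSym.to_jacobiSym, ← neg_one_mul, jacobiSym.mul_left, em1', one_mul,
    jacobiSym.quadratic_reciprocity_one_mod_four hb4 hpodd, e]

/-- Gauss: every natural number congruent to `3` modulo `8` is a sum of three squares. -/
theorem Nat.exists_sum_three_squares_of_mod_eight_eq_three {m : ℕ} (hm : m % 8 = 3) :
    ∃ x y z : ℤ, x ^ 2 + y ^ 2 + z ^ 2 = m := by
  obtain ⟨n, rfl⟩ : ∃ n, m = 8 * n + 3 := ⟨m / 8, by omega⟩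
  have hcop : Nat.Coprime (4 * n + 1) (4 * (8 * n + 3)) := by
    refine Nat.Coprime.mul_right ?_ ?_
    · rw [show 4 * n + 1 = 1 + 4 * n by ring]
      simp
    · rw [show 8 * n + 3 = 1 + 2 * (4 * n + 1) by ring]
      simp
  -- Dirichlet: with `m = 8n + 3`, a prime `p = 4mv + (4n + 1)` satisfies `2p + 1 = (8v + 1) m`, the
  -- determinant condition of the form built at the end.
  obtain ⟨p, hpgt, hp, hpmod⟩ := Nat.forall_exists_prime_gt_and_modEq (4 * n + 1) (by positivity)
    hcop
  obtain ⟨v, hv⟩ : ∃ v, p = 4 * (8 * n + 3) * v + (4 * n + 1) := by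
    obtain ⟨v, hv⟩ := (Nat.modEq_iff_dvd' hpgt.le).1 hpmod.symm
    exact ⟨v, by omega⟩
  have : Fact p.Prime := ⟨hp⟩
  have hp4 : p % 4 = 1 := by
    rw [hv, mul_assoc]; omega
  have key : 2 * p + 1 = (8 * v + 1) * (8 * n + 3) := by rw [hv]; ring
  have hl := legendreSym_neg_eq_one_of_two_mul_add_one_eq (m := 8 * n + 3) (b := 8 * v + 1) hp4
    (by omega) key
  have hex : ∃ s : ℤ, (p : ℤ) ∣ s ^ 2 + (8 * v + 1) := by
    have hne : ((-((8 * v + 1 : ℕ) : ℤ) : ℤ) : ZMod p) ≠ 0 := by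
      intro h0
      rw [(legendreSym.eq_zero_iff p _).2 h0] at hl
      exact zero_ne_one hl
    obtain ⟨w, hw⟩ := (legendreSym.eq_one_iff p hne).1 hl
    refine ⟨w.val, ?_⟩
    rw [← ZMod.intCast_zmod_eq_zero_iff_dvd]
    push_cast at hw ⊢
    rw [ZMod.natCast_zmod_val]
    linear_combination -hw
  -- An odd root makes `s² + 8v + 1` even, which lifts divisibility from `p` to `2p`; adding the odd
  -- `p` changes the parity.
  obtain ⟨s, hs, hsodd⟩ : ∃ s : ℤ, (p : ℤ) ∣ s ^ 2 + (8 * v + 1) ∧ s % 2 = 1 := by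
    obtain ⟨s, hs⟩ := hex
    rcases Int.emod_two_eq_zero_or_one s with h | h
    · refine ⟨s + p, ?_, by omega⟩
      have : (s + p) ^ 2 + (8 * (v : ℤ) + 1) = (s ^ 2 + (8 * v + 1)) + p * (2 * s + p) := by ring
      rw [this]
      exact dvd_add hs (dvd_mul_right _ _)
    · exact ⟨s, hs, h⟩
  have h2p : (2 * p : ℤ) ∣ s ^ 2 + (8 * v + 1) := by
    refine IsCoprime.mul_dvd ?_ ?_ hs
    · rw [Int.isCoprime_iff_gcd_eq_one]
      have : Nat.Coprime 2 p := by
        rw [Nat.coprime_two_left]; exact Nat.odd_iff.2 (by omega)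
      exact_mod_cast this
    · obtain ⟨t, rfl⟩ : ∃ t, s = 2 * t + 1 := ⟨s / 2, by omega⟩
      exact ⟨2 * t ^ 2 + 2 * t + 4 * v + 1, by ring⟩
  obtain ⟨a, ha⟩ := h2p
  have hp0 : (0 : ℤ) < p := by exact_mod_cast hp.pos
  have hv0 : (0 : ℤ) ≤ v := by positivity
  have ha0 : 0 < a := by
    by_contra hle
    nlinarith [sq_nonneg s]
  have keyZ : 2 * (p : ℤ) + 1 = (8 * v + 1) * (8 * n + 3) := by exact_mod_cast key
  -- The Gram matrix is `[[a, s, 1], [s, 2p, 0], [1, 0, m]]`: its second minor is `2pa - s² = 8v +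
  -- 1`, its determinant `m (8v + 1) - 2p = 1`, and `(0, 0, 1)` represents `m`.
  refine UnimodularTernaryRep.exists_sum_three_squares ha0 (A := 8 * v + 1) (by positivity)
    ⟨2 * p, 8 * n + 3, s, 1, 0, 0, 0, 1, ?_, ?_, ?_⟩
  · linear_combination -ha
  · linear_combination -(8 * (n : ℤ) + 3) * ha - keyZ
  · push_cast; ring

/-! ### Periodizations and Fourier coefficients at lattice points -/

section Periodization

variable {d : ℕ}

theorem tsum_indicator_closedBall_add_latticePoint_le (d : ℕ) (R : ℝ) :
    ∃ M : ℝ≥0, ∀ x : EuclideanSpace ℝ (Fin d),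
      ∑' ν : Fin d → ℤ, (Metric.closedBall 0 R).indicator (1 : EuclideanSpace ℝ (Fin d) → ℝ≥0∞)
        (x + latticePoint ν) ≤ M := by
  refine ⟨((⌈2 * R + 1⌉.toNat) ^ d : ℕ), fun x => ?_⟩
  set s : Finset (Fin d → ℤ) := Finset.Icc (fun i => ⌈-R - x i⌉) (fun i => ⌊R - x i⌋) with hs
  have h0 : ∀ ν ∉ s, (Metric.closedBall 0 R).indicator (1 : EuclideanSpace ℝ (Fin d) → ℝ≥0∞)
      (x + latticePoint ν) = 0 := by
    intro ν hν
    refine Set.indicator_of_notMem (fun hmem => hν ?_) _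
    rw [mem_closedBall_zero_iff] at hmem
    have hi : ∀ i, |x i + ν i| ≤ R := fun i =>
      (PiLp.norm_apply_le (x + latticePoint ν) i).trans hmem
    rw [hs, Finset.mem_Icc]
    refine ⟨fun i => Int.ceil_le.2 ?_, fun i => Int.le_floor.2 ?_⟩
    · linarith [(abs_le.1 (hi i)).1]
    · linarith [(abs_le.1 (hi i)).2]
  rw [tsum_eq_sum h0]
  calc _ ≤ ∑ ν ∈ s, (1 : ℝ≥0∞) := by
        refine Finset.sum_le_sum fun ν _ => ?_
        exact Set.indicator_le_self' (fun _ _ => zero_le_one) _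
    _ = ((s.card : ℕ) : ℝ≥0∞) := by simp
    _ ≤ _ := by
        rw [ENNReal.coe_natCast, Nat.cast_le, hs, Pi.card_Icc]
        calc _ ≤ ∏ i : Fin d, ⌈2 * R + 1⌉.toNat := by
              refine Finset.prod_le_prod' fun i _ => ?_
              rw [Int.card_Icc]
              refine Int.toNat_le_toNat ?_
              rw [Int.le_ceil_iff]
              push_cast
              have h1 := Int.floor_le (R - x i)
              have h2 := Int.le_ceil (-R - x i)
              linarith
          _ = _ := by simp

theorem aestronglyMeasurable_comp_sub {f : EuclideanSpace ℝ (Fin d) → ℂ}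
    (hf : AEStronglyMeasurable f volume) (a : EuclideanSpace ℝ (Fin d)) :
    AEStronglyMeasurable (fun x => f (x - a)) volume :=
  hf.comp_measurePreserving (measurePreserving_sub_right volume a)

/-- A bounded function with bounded support. -/
structure BoundedWithBoundedSupport (φ : EuclideanSpace ℝ (Fin d) → ℂ) : Prop where
  aestronglyMeasurable : AEStronglyMeasurable φ volume
  exists_bound : ∃ (B : ℝ≥0) (R : ℝ), ∀ x, ‖φ x‖ₑ ≤ B * (Metric.closedBall 0 R).indicator 1 x

theorem BoundedWithBoundedSupport.tsum_enorm_le {φ : EuclideanSpace ℝ (Fin d) → ℂ}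
    (hφ : BoundedWithBoundedSupport φ) :
    ∃ M : ℝ≥0, ∀ x, ∑' ν : Fin d → ℤ, ‖φ (x + latticePoint ν)‖ₑ ≤ M := by
  obtain ⟨B, R, h⟩ := hφ.exists_bound
  obtain ⟨M, hM⟩ := tsum_indicator_closedBall_add_latticePoint_le d R
  refine ⟨B * M, fun x => ?_⟩
  calc _ ≤ ∑' ν : Fin d → ℤ, B * (Metric.closedBall 0 R).indicator
          (1 : EuclideanSpace ℝ (Fin d) → ℝ≥0∞) (x + latticePoint ν) :=
        ENNReal.tsum_le_tsum fun ν => h _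
    _ ≤ _ := by
        rw [ENNReal.tsum_mul_left, ENNReal.coe_mul]
        gcongr
        exact hM x

theorem tsum_lintegral_enorm_translate_mul_lt_top {F φ : EuclideanSpace ℝ (Fin d) → ℂ}
    (hF : Integrable F) (hφ : BoundedWithBoundedSupport φ) :
    ∑' ν : Fin d → ℤ, ∫⁻ x, ‖F x * φ (x + latticePoint ν)‖ₑ ≠ ∞ := by
  obtain ⟨M, hM⟩ := hφ.tsum_enorm_le
  have hmeas : ∀ ν : Fin d → ℤ, AEStronglyMeasurable (fun x => F x * φ (x + latticePoint ν)) :=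
    fun ν => hF.aestronglyMeasurable.mul (hφ.aestronglyMeasurable.comp_measurePreserving
      (measurePreserving_add_right volume (latticePoint ν)))
  rw [← lintegral_tsum fun ν => (hmeas ν).enorm]
  refine ne_top_of_le_ne_top (b := ∫⁻ x, ‖F x‖ₑ * M) ?_ (lintegral_mono fun x => ?_)
  · rw [lintegral_mul_const' _ _ ENNReal.coe_ne_top]
    exact ENNReal.mul_ne_top hF.hasFiniteIntegral.ne ENNReal.coe_ne_top
  · simp_rw [enorm_mul]
    rw [ENNReal.tsum_mul_left]
    gcongr
    exact hM x

theorem lintegral_enorm_translate_mul (F φ : EuclideanSpace ℝ (Fin d) → ℂ)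
    (a : EuclideanSpace ℝ (Fin d)) :
    ∫⁻ x, ‖F (x - a) * φ x‖ₑ = ∫⁻ x, ‖F x * φ (x + a)‖ₑ := by
  rw [← lintegral_add_right_eq_self (fun x => ‖F (x - a) * φ x‖ₑ) a]
  simp

/-- Unfolding: testing a periodized function against `φ` is testing the function against the
periodization of `φ`. -/
theorem integral_tsum_translate_mul {F φ : EuclideanSpace ℝ (Fin d) → ℂ}
    (hF : Integrable F) (hφ : BoundedWithBoundedSupport φ) :
    ∫ x, (∑' ν : Fin d → ℤ, F (x - latticePoint ν)) * φ x =
      ∫ x, F x * ∑' ν : Fin d → ℤ, φ (x + latticePoint ν) := by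
  have hfin := tsum_lintegral_enorm_translate_mul_lt_top hF hφ
  have h1 : ∫ x, ∑' ν : Fin d → ℤ, F (x - latticePoint ν) * φ x =
      ∑' ν : Fin d → ℤ, ∫ x, F (x - latticePoint ν) * φ x := by
    refine integral_tsum (fun ν => (aestronglyMeasurable_comp_sub hF.aestronglyMeasurable _).mul
      hφ.aestronglyMeasurable) ?_
    simpa only [lintegral_enorm_translate_mul] using hfin
  have h2 : ∫ x, ∑' ν : Fin d → ℤ, F x * φ (x + latticePoint ν) =
      ∑' ν : Fin d → ℤ, ∫ x, F x * φ (x + latticePoint ν) := by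
    refine integral_tsum (fun ν => hF.aestronglyMeasurable.mul
      (hφ.aestronglyMeasurable.comp_measurePreserving
      (measurePreserving_add_right volume (latticePoint ν)))) hfin
  simp_rw [tsum_mul_right, tsum_mul_left] at h1 h2
  rw [h1, h2]
  refine tsum_congr fun ν => ?_
  rw [← integral_add_right_eq_self (fun x => F (x - latticePoint ν) * φ x) (latticePoint ν)]
  simp

theorem integrableOn_closedBall_tsum_translate {F : EuclideanSpace ℝ (Fin d) → ℂ}
    (hF : Integrable F) (R : ℝ) :
    IntegrableOn (fun x => ∑' ν : Fin d → ℤ, F (x - latticePoint ν)) (Metric.closedBall 0 R) := by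
  have hφ : BoundedWithBoundedSupport ((Metric.closedBall 0 R).indicator
      (1 : EuclideanSpace ℝ (Fin d) → ℂ)) := by
    refine ⟨(stronglyMeasurable_one.indicator
      Metric.isClosed_closedBall.measurableSet).aestronglyMeasurable, 1, R, fun x => ?_⟩
    by_cases hx : x ∈ Metric.closedBall (0 : EuclideanSpace ℝ (Fin d)) R
    · rw [Set.indicator_of_mem hx, Set.indicator_of_mem hx]; simp
    · rw [Set.indicator_of_notMem hx, Set.indicator_of_notMem hx]; simp
  have hfin := tsum_lintegral_enorm_translate_mul_lt_top hF hφ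
  have hm : ∀ ν : Fin d → ℤ, AEStronglyMeasurable (fun x => F (x - latticePoint ν)) :=
    fun ν => aestronglyMeasurable_comp_sub hF.aestronglyMeasurable _
  refine ⟨?_, ?_⟩
  · have h0 : AEMeasurable (fun x => ∑' ν : Fin d → ℤ, F (x - latticePoint ν)) :=
      AEMeasurable.tsum fun ν => (hm ν).aemeasurable
    exact h0.aestronglyMeasurable.restrict
  · rw [hasFiniteIntegral_iff_enorm]
    refine lt_of_le_of_lt ?_ hfin.lt_top
    simp_rw [← lintegral_enorm_translate_mul]
    have hsum := lintegral_tsum (μ := volume) (f := fun (ν : Fin d → ℤ) x =>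
      ‖F (x - latticePoint ν) * (Metric.closedBall 0 R).indicator
        (1 : EuclideanSpace ℝ (Fin d) → ℂ) x‖ₑ)
      fun ν => ((hm ν).mul hφ.aestronglyMeasurable).enorm
    rw [← hsum, ← lintegral_indicator Metric.isClosed_closedBall.measurableSet]
    refine lintegral_mono fun x => ?_
    by_cases hx : x ∈ Metric.closedBall (0 : EuclideanSpace ℝ (Fin d)) R
    · simp only [Set.indicator_of_mem hx, Pi.one_apply, mul_one]
      exact enorm_tsum_le_tsum_enorm
    · rw [Set.indicator_of_notMem hx]; exact zero_le

theorem locallyIntegrable_tsum_translate {F : EuclideanSpace ℝ (Fin d) → ℂ}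
    (hF : Integrable F) :
    LocallyIntegrable (fun x => ∑' ν : Fin d → ℤ, F (x - latticePoint ν)) := by
  intro x
  refine ⟨Metric.closedBall 0 (‖x‖ + 1), Metric.closedBall_mem_nhds_of_mem ?_,
    integrableOn_closedBall_tsum_translate hF _⟩
  simp


/-- The character `e` cut off to the half-open unit cube periodizes back to `e`, because the
translates of the cube tile space. Unfolding against this test function produces `𝓕 F` at `m`. -/
theorem fourier_latticePoint_eq_zero_of_tsum_translate_ae_eq_zero
    {F : EuclideanSpace ℝ (Fin d) → ℂ} (hF : Integrable F)
    (h : (fun x => ∑' ν : Fin d → ℤ, F (x - latticePoint ν)) =ᵐ[volume] 0) (m : Fin d → ℤ) :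
    𝓕 F (latticePoint m) = 0 := by
  set e : EuclideanSpace ℝ (Fin d) → ℂ := fun x =>
    (Real.fourierChar (-(inner ℝ x (latticePoint m))) : ℂ) with he
  set cube : Set (EuclideanSpace ℝ (Fin d)) := {x | ∀ i, x i ∈ Set.Ico (0 : ℝ) 1} with hcube
  have hcm : MeasurableSet cube := by
    rw [hcube, Set.ofPred_forall]
    exact MeasurableSet.iInter fun i =>
      measurableSet_Ico.preimage (EuclideanSpace.proj (𝕜 := ℝ) i).continuous.measurable
  have hec : Continuous e := by fun_prop
  have hφ : BoundedWithBoundedSupport (cube.indicator e) := by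
    refine ⟨(hec.stronglyMeasurable.indicator hcm).aestronglyMeasurable, 1, √d, fun x => ?_⟩
    by_cases hx : x ∈ cube
    · have hx' : x ∈ Metric.closedBall (0 : EuclideanSpace ℝ (Fin d)) √d := by
        rw [mem_closedBall_zero_iff, EuclideanSpace.norm_eq]
        refine Real.sqrt_le_sqrt ?_
        calc _ ≤ ∑ i : Fin d, (1 : ℝ) := by
              refine Finset.sum_le_sum fun i _ => ?_
              rw [Real.norm_eq_abs, sq_abs]
              nlinarith [(hx i).1, (hx i).2]
          _ = d := by simp
      rw [Set.indicator_of_mem hx, Set.indicator_of_mem hx', ← ofReal_norm]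
      simp only [he, Circle.norm_coe]
      simp
    · rw [Set.indicator_of_notMem hx]; simp
  have hper : ∀ x, ∑' ν : Fin d → ℤ, cube.indicator e (x + latticePoint ν) = e x := by
    intro x
    rw [tsum_eq_single (fun i => -⌊x i⌋)]
    · rw [Set.indicator_of_mem]
      · simp only [he, inner_add_left, neg_add]
        rw [AddChar.map_add_eq_mul]
        have hint : inner ℝ (latticePoint fun i => -⌊x i⌋) (latticePoint m) =
            ((∑ i, m i * (-⌊x i⌋) : ℤ) : ℝ) := by
          simp [latticePoint, PiLp.inner_apply]
        rw [hint, ← Int.cast_neg]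
        have : Real.fourierChar (((-∑ i, m i * (-⌊x i⌋) : ℤ) : ℝ)) = 1 := by
          ext
          rw [Real.fourierChar_apply]
          push_cast
          rw [Complex.exp_eq_one_iff]
          exact ⟨-∑ i, m i * (-⌊x i⌋), by push_cast; ring⟩
        rw [this, mul_one]
      · intro i
        simp only [latticePoint, PiLp.add_apply]
        push_cast
        exact ⟨by linarith [Int.floor_le (x i)], by linarith [Int.lt_floor_add_one (x i)]⟩
    · intro ν hν
      refine Set.indicator_of_notMem (fun hmem => hν (funext fun i => ?_)) _
      have hi : x i + ν i ∈ Set.Ico (0 : ℝ) 1 := hmem i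
      have : ⌊x i⌋ = -ν i := by
        rw [Int.floor_eq_iff]
        push_cast
        exact ⟨by linarith [hi.1], by linarith [hi.2]⟩
      rw [this, neg_neg]
  have hunf := integral_tsum_translate_mul hF hφ
  simp_rw [hper] at hunf
  rw [Real.fourier_eq]
  calc _ = ∫ x, F x * e x := by
        refine integral_congr_ae (Filter.Eventually.of_forall fun x => ?_)
        simp only [he, Circle.smul_def, smul_eq_mul]
        ring
    _ = ∫ x, (∑' ν : Fin d → ℤ, F (x - latticePoint ν)) * cube.indicator e x := hunf.symm
    _ = 0 := by
        refine (integral_congr_ae (h.mono fun x hx => ?_)).trans (integral_zero _ ℂ)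
        simp only at hx
        simp only [hx, Pi.zero_apply, zero_mul]

/-- The projection of `ℝ^d` onto the torus `ℝ^d / ℤ^d`. -/
noncomputable def toTorus (x : EuclideanSpace ℝ (Fin d)) : UnitAddTorus (Fin d) :=
  fun i => (x i : UnitAddCircle)

theorem isOpenQuotientMap_toTorus : IsOpenQuotientMap (toTorus (d := d)) := by
  have h1 : IsOpenQuotientMap (Pi.map fun (_ : Fin d) (t : ℝ) => (t : UnitAddCircle)) :=
    IsOpenQuotientMap.piMap fun _ => QuotientAddGroup.isOpenQuotientMap_mk
  exact h1.comp (EuclideanSpace.equiv (Fin d) ℝ).toHomeomorph.isOpenQuotientMap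

theorem mFourier_toTorus (m : Fin d → ℤ) (x : EuclideanSpace ℝ (Fin d)) :
    UnitAddTorus.mFourier m (toTorus x) = Real.fourierChar (inner ℝ x (latticePoint m)) := by
  rw [Real.fourierChar_apply]
  simp only [UnitAddTorus.mFourier, ContinuousMap.coe_mk, toTorus, fourier_coe_apply, latticePoint,
    PiLp.inner_apply]
  rw [← Complex.exp_sum]
  congr 1
  simp [Finset.mul_sum, Finset.sum_mul]
  refine Finset.sum_congr rfl fun i _ => by ring

theorem toTorus_eq_iff {x y : EuclideanSpace ℝ (Fin d)} :
    toTorus x = toTorus y ↔ ∃ n : Fin d → ℤ, y = x + latticePoint n := by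
  constructor
  · intro h
    have hi : ∀ i, ∃ n : ℤ, y i = x i + n := by
      intro i
      have := congrFun h i
      simp only [toTorus] at this
      rw [QuotientAddGroup.eq, AddSubgroup.mem_zmultiples_iff] at this
      obtain ⟨n, hn⟩ := this
      refine ⟨n, ?_⟩
      simp at hn
      linarith
    choose n hn using hi
    exact ⟨n, by ext i; simpa [latticePoint] using hn i⟩
  · rintro ⟨n, rfl⟩
    funext i
    simp [toTorus, latticePoint]

/-- The functional `Ψ ↦ ∫ F Ψ` is bounded in the sup norm because `F` is integrable, and it kills
the characters, whose span is dense in `C(𝕋^d)`. -/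
theorem integral_mul_toTorus_eq_zero {F : EuclideanSpace ℝ (Fin d) → ℂ} (hF : Integrable F)
    (h : ∀ m : Fin d → ℤ, 𝓕 F (latticePoint m) = 0) (Ψ : C(UnitAddTorus (Fin d), ℂ)) :
    ∫ x, F x * Ψ (toTorus x) = 0 := by
  have hint : ∀ Ψ : C(UnitAddTorus (Fin d), ℂ), Integrable fun x => F x * Ψ (toTorus x) := by
    intro Ψ
    refine hF.mul_bdd (c := ‖Ψ‖) ?_ (Filter.Eventually.of_forall fun x => Ψ.norm_coe_le_norm _)
    exact (Ψ.continuous.comp isOpenQuotientMap_toTorus.continuous).aestronglyMeasurable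
  let T : C(UnitAddTorus (Fin d), ℂ) →L[ℂ] ℂ := LinearMap.mkContinuous
    { toFun := fun Ψ => ∫ x, F x * Ψ (toTorus x)
      map_add' := fun Ψ₁ Ψ₂ => by
        simp only [ContinuousMap.add_apply, mul_add]
        exact integral_add (hint Ψ₁) (hint Ψ₂)
      map_smul' := fun c Ψ => by
        simp only [ContinuousMap.smul_apply, smul_eq_mul, RingHom.id_apply, mul_left_comm]
        exact integral_const_mul _ _ } (∫ x, ‖F x‖) fun Ψ => by
    refine (norm_integral_le_integral_norm _).trans ?_
    rw [← integral_mul_const]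
    refine integral_mono (hint Ψ).norm (hF.norm.mul_const _) fun x => ?_
    simp only [norm_mul]
    gcongr
    exact Ψ.norm_coe_le_norm _
  have hker : (Submodule.span ℂ (Set.range <| UnitAddTorus.mFourier (d := Fin d))) ≤ T.ker := by
    rw [Submodule.span_le]
    rintro _ ⟨m, rfl⟩
    have hm := h (-m)
    rw [Real.fourier_eq] at hm
    change ∫ x, F x * UnitAddTorus.mFourier m (toTorus x) = 0
    rw [← hm]
    refine integral_congr_ae (Filter.Eventually.of_forall fun x => ?_)
    have : latticePoint (-m) = -latticePoint m := by ext i; simp [latticePoint]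
    simp only [mFourier_toTorus, this, inner_neg_right, neg_neg, Circle.smul_def, smul_eq_mul]
    ring
  have htop := Submodule.topologicalClosure_minimal _ hker T.isClosed_ker
  rw [UnitAddTorus.span_mFourier_closure_eq_top] at htop
  exact htop (Submodule.mem_top (x := Ψ))

theorem HasCompactSupport.boundedWithBoundedSupport {φ : EuclideanSpace ℝ (Fin d) → ℂ}
    (hφ : Continuous φ) (hc : HasCompactSupport φ) : BoundedWithBoundedSupport φ := by
  obtain ⟨B, hB⟩ := hc.exists_bound_of_continuous hφ
  obtain ⟨R, hR⟩ := hc.isBounded.subset_closedBall 0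
  refine ⟨hφ.aestronglyMeasurable, B.toNNReal, R, fun x => ?_⟩
  by_cases hx : x ∈ Metric.closedBall (0 : EuclideanSpace ℝ (Fin d)) R
  · rw [Set.indicator_of_mem hx, ← ofReal_norm, Pi.one_apply, mul_one]
    exact ENNReal.ofReal_le_ofReal (hB x)
  · rw [image_eq_zero_of_notMem_tsupport fun h => hx (hR h)]
    simp

theorem BoundedWithBoundedSupport.locallyFinite_support {φ : EuclideanSpace ℝ (Fin d) → ℂ}
    (hφ : BoundedWithBoundedSupport φ) :
    LocallyFinite fun ν : Fin d → ℤ => Function.support fun x => φ (x + latticePoint ν) := by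
  obtain ⟨B, R, hB⟩ := hφ.exists_bound
  intro x
  refine ⟨Metric.ball x 1, Metric.ball_mem_nhds x one_pos, ?_⟩
  obtain ⟨M, hM⟩ := tsum_indicator_closedBall_add_latticePoint_le d (R + 1)
  have hfin := ENNReal.finite_const_le_of_tsum_ne_top
    (ne_top_of_le_ne_top ENNReal.coe_ne_top (hM x))
    one_ne_zero
  refine hfin.subset ?_
  rintro ν ⟨y, hy, hyx⟩
  have hyR : ‖y + latticePoint ν‖ ≤ R := by
    by_contra hlt
    have h1 := hB (y + latticePoint ν)
    rw [Set.indicator_of_notMem (by simpa using hlt), mul_zero] at h1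
    exact hy (by simpa using h1)
  have hmem : x + latticePoint ν ∈ Metric.closedBall (0 : EuclideanSpace ℝ (Fin d)) (R + 1) := by
    rw [mem_closedBall_zero_iff]
    have : x + latticePoint ν = (y + latticePoint ν) + (x - y) := by abel
    rw [this]
    refine (norm_add_le _ _).trans (add_le_add hyR ?_)
    rw [Metric.mem_ball, dist_eq_norm, norm_sub_rev] at hyx
    exact hyx.le
  simp only [Set.mem_ofPred_eq]
  rw [Set.indicator_of_mem hmem]
  rfl

/-- The sum is locally finite, hence continuous, and it is lattice-invariant, so it descends through
the open quotient map `toTorus`. -/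
theorem exists_continuousMap_torus_eq_tsum {φ : EuclideanSpace ℝ (Fin d) → ℂ}
    (hφ : Continuous φ) (hc : HasCompactSupport φ) :
    ∃ Ψ : C(UnitAddTorus (Fin d), ℂ), ∀ x,
      Ψ (toTorus x) = ∑' ν : Fin d → ℤ, φ (x + latticePoint ν) := by
  have hlf := (hc.boundedWithBoundedSupport hφ).locallyFinite_support
  have hcont : Continuous fun x => ∑' ν : Fin d → ℤ, φ (x + latticePoint ν) := by
    have : (fun x => ∑' ν : Fin d → ℤ, φ (x + latticePoint ν)) =
        fun x => ∑ᶠ ν : Fin d → ℤ, φ (x + latticePoint ν) := by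
      funext x
      refine tsum_eq_finsum ?_
      exact hlf.point_finite x
    rw [this]
    exact continuous_finsum (fun ν => by fun_prop) hlf
  have hfac : Function.FactorsThrough
      (⟨fun x => ∑' ν : Fin d → ℤ, φ (x + latticePoint ν), hcont⟩ : C(_, ℂ))
      (⟨toTorus, isOpenQuotientMap_toTorus.continuous⟩ : C(EuclideanSpace ℝ (Fin d), _)) := by
    intro x y hxy
    obtain ⟨n, rfl⟩ := toTorus_eq_iff.1 hxy
    simp only [ContinuousMap.coe_mk]
    rw [← (Equiv.addLeft n).tsum_eq (fun ν => φ (x + latticePoint ν))]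
    refine tsum_congr fun ν => ?_
    congr 1
    ext i
    simp [latticePoint, add_assoc]
  refine ⟨isOpenQuotientMap_toTorus.isQuotientMap.lift
    (f := ⟨toTorus, isOpenQuotientMap_toTorus.continuous⟩) _ hfac, fun x => ?_⟩
  exact congrArg (fun g => g x) (Topology.IsQuotientMap.lift_comp
    (f := (⟨toTorus, isOpenQuotientMap_toTorus.continuous⟩ : C(EuclideanSpace ℝ (Fin d), _)))
    isOpenQuotientMap_toTorus.isQuotientMap _ hfac)

/-- The periodization of an integrable function vanishes if and only if its Fourier transform
vanishes at all lattice points. -/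
theorem tsum_translate_ae_eq_zero_iff {F : EuclideanSpace ℝ (Fin d) → ℂ} (hF : Integrable F) :
    (fun x => ∑' ν : Fin d → ℤ, F (x - latticePoint ν)) =ᵐ[volume] 0 ↔
      ∀ m : Fin d → ℤ, 𝓕 F (latticePoint m) = 0 := by
  refine ⟨fourier_latticePoint_eq_zero_of_tsum_translate_ae_eq_zero hF, fun h => ?_⟩
  -- Converse: testing the periodization against a bump function unfolds to `F` paired with a
  -- continuous function on the torus.
  refine ae_eq_zero_of_integral_contDiff_smul_eq_zero (locallyIntegrable_tsum_translate hF)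
    fun g hg hgc => ?_
  have hc : Continuous fun x => (g x : ℂ) := Complex.continuous_ofReal.comp hg.continuous
  have hcs : HasCompactSupport fun x => (g x : ℂ) := hgc.comp_left (g := ((↑) : ℝ → ℂ)) rfl
  obtain ⟨Ψ, hΨ⟩ := exists_continuousMap_torus_eq_tsum hc hcs
  have := integral_tsum_translate_mul hF (hcs.boundedWithBoundedSupport hc)
  simp_rw [← hΨ] at this
  rw [integral_mul_toTorus_eq_zero hF h] at this
  rw [← this]
  refine integral_congr_ae (Filter.Eventually.of_forall fun x => ?_)
  simp [mul_comm]

end Periodization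

/-! ### Rotations, and the equivalence (i) -/

section Rotation

variable {d : ℕ}

/-- A rotation matrix as a linear isometry of Euclidean space. -/
noncomputable def SO.toIsometryEquiv (ρ : SO d) :
    EuclideanSpace ℝ (Fin d) ≃ₗᵢ[ℝ] EuclideanSpace ℝ (Fin d) :=
  LinearIsometry.toLinearIsometryEquiv
    ((Matrix.toEuclideanLin (ρ : Matrix (Fin d) (Fin d) ℝ)).isometryOfInner fun x y => by
      rw [← LinearMap.adjoint_inner_left, ← Matrix.toEuclideanLin_conjTranspose_eq_adjoint,
        ← LinearMap.comp_apply]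
      have h1 : (ρ : Matrix (Fin d) (Fin d) ℝ)ᴴ * (ρ : Matrix (Fin d) (Fin d) ℝ) = 1 :=
        Matrix.mem_unitaryGroup_iff'.1 (Matrix.mem_specialOrthogonalGroup_iff.1 ρ.2).1
      have h2 : (Matrix.toEuclideanLin (ρ : Matrix (Fin d) (Fin d) ℝ)ᴴ) ∘ₗ
          (Matrix.toEuclideanLin (ρ : Matrix (Fin d) (Fin d) ℝ)) = LinearMap.id := by
        ext1 z
        rw [Matrix.conjTranspose_eq_transpose_of_trivial] at h1
        simp [Matrix.toLpLin_apply, Matrix.mulVec_mulVec, h1]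
      rw [h2]
      rfl) rfl

theorem SO.toIsometryEquiv_apply (ρ : SO d) (x : EuclideanSpace ℝ (Fin d)) :
    ρ.toIsometryEquiv x = Matrix.toEuclideanLin (ρ : Matrix (Fin d) (Fin d) ℝ) x := rfl

theorem LinearIsometryEquiv.exists_SO_of_det_eq_one
    (T : EuclideanSpace ℝ (Fin d) ≃ₗᵢ[ℝ] EuclideanSpace ℝ (Fin d))
    (hT : LinearMap.det
      (T.toLinearEquiv : EuclideanSpace ℝ (Fin d) →ₗ[ℝ] EuclideanSpace ℝ (Fin d)) = 1) :
    ∃ ρ : SO d, ∀ x, ρ.toIsometryEquiv x = T x := by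
  set L : EuclideanSpace ℝ (Fin d) →ₗ[ℝ] EuclideanSpace ℝ (Fin d) := T.toLinearEquiv.toLinearMap
    with hL
  set A : Matrix (Fin d) (Fin d) ℝ := Matrix.toEuclideanLin.symm L with hA
  have hAL : Matrix.toEuclideanLin A = L := LinearEquiv.apply_symm_apply _ _
  have hmem : A ∈ Matrix.specialOrthogonalGroup (Fin d) ℝ := by
    rw [Matrix.mem_specialOrthogonalGroup_iff]
    constructor
    · refine Matrix.mem_unitaryGroup_iff'.2 ?_
      apply Matrix.toEuclideanLin.injective
      have h3 : Matrix.toEuclideanLin (star A * A) =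
          (Matrix.toEuclideanLin Aᴴ) ∘ₗ (Matrix.toEuclideanLin A) := by
        ext1 z
        simp [Matrix.toLpLin_apply, Matrix.mulVec_mulVec, Matrix.star_eq_conjTranspose]
      rw [h3, Matrix.toEuclideanLin_conjTranspose_eq_adjoint, hAL]
      ext1 z
      refine ext_inner_right ℝ fun w => ?_
      rw [LinearMap.comp_apply, LinearMap.adjoint_inner_left]
      have : inner ℝ (L z) (L w) = inner ℝ z w := T.inner_map_map z w
      rw [this]
      simp
    · rw [← hT, ← hAL]
      change _ = LinearMap.det (Matrix.toLpLin 2 2 A)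
      rw [Matrix.toLpLin_eq_toLin, LinearMap.det_toLin]
  refine ⟨⟨A, hmem⟩, fun x => ?_⟩
  rw [SO.toIsometryEquiv_apply, hAL]
  rfl

theorem LinearIsometryEquiv.det_eq_one_or_neg_one {V : Type*} [NormedAddCommGroup V]
    [InnerProductSpace ℝ V] [FiniteDimensional ℝ V] (T : V ≃ₗᵢ[ℝ] V) :
    LinearMap.det (T.toLinearEquiv : V →ₗ[ℝ] V) = 1 ∨
      LinearMap.det (T.toLinearEquiv : V →ₗ[ℝ] V) = -1 := by
  rw [← abs_eq one_pos.le, ← LinearMap.normDet_eq_abs_det]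
  exact T.toLinearIsometry.normDet_eq_one

/-- The reflection exchanging `η` and `ξ` has determinant `±1`. If it is `-1`, a further reflection
in a hyperplane containing `ξ` corrects the sign; such a hyperplane exists because `d ≥ 2`. -/
theorem SO.exists_apply_eq (hd : 2 ≤ d) {η ξ : EuclideanSpace ℝ (Fin d)} (h : ‖η‖ = ‖ξ‖) :
    ∃ ρ : SO d, ρ.toIsometryEquiv η = ξ := by
  obtain ⟨T, hT⟩ : ∃ T : EuclideanSpace ℝ (Fin d) ≃ₗᵢ[ℝ] EuclideanSpace ℝ (Fin d), T η = ξ :=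
    ⟨_, Submodule.reflection_sub h⟩
  rcases T.det_eq_one_or_neg_one with h1 | h1
  · obtain ⟨ρ, hρ⟩ := T.exists_SO_of_det_eq_one h1
    exact ⟨ρ, (hρ η).trans hT⟩
  · obtain ⟨u, hu0, hu⟩ : ∃ u : EuclideanSpace ℝ (Fin d), u ≠ 0 ∧ inner ℝ u ξ = 0 := by
      have hlt : Module.finrank ℝ (ℝ ∙ ξ) < Module.finrank ℝ (EuclideanSpace ℝ (Fin d)) := by
        rw [finrank_euclideanSpace_fin]
        exact (finrank_span_le_card {ξ}).trans_lt (by simp; omega)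
      have hne : (ℝ ∙ ξ)ᗮ ≠ ⊥ := by
        intro hbot
        rw [Submodule.orthogonal_eq_bot_iff] at hbot
        rw [hbot, finrank_top] at hlt
        exact lt_irrefl _ hlt
      obtain ⟨u, hu, hu0⟩ := Submodule.exists_mem_ne_zero_of_ne_bot hne
      rw [Submodule.mem_orthogonal_singleton_iff_inner_right, real_inner_comm] at hu
      exact ⟨u, hu0, hu⟩
    set S := (ℝ ∙ u)ᗮ.reflection with hS
    have hSξ : S ξ = ξ := by
      rw [hS, Submodule.reflection_eq_self_iff]
      exact Submodule.mem_orthogonal_singleton_iff_inner_right.2 hu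
    have hSdet : LinearMap.det
        (S.toLinearEquiv : EuclideanSpace ℝ (Fin d) →ₗ[ℝ] EuclideanSpace ℝ (Fin d)) = -1 := by
      have := (ℝ ∙ u)ᗮ.det_reflection
      rw [Submodule.orthogonal_orthogonal, finrank_span_singleton hu0, pow_one] at this
      exact this
    obtain ⟨ρ, hρ⟩ := (T.trans S).exists_SO_of_det_eq_one (by
      have : ((T.trans S).toLinearEquiv : EuclideanSpace ℝ (Fin d) →ₗ[ℝ]
        EuclideanSpace ℝ (Fin d)) =
        (S.toLinearEquiv : EuclideanSpace ℝ (Fin d) →ₗ[ℝ] EuclideanSpace ℝ (Fin d)) ∘ₗ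
          (T.toLinearEquiv : EuclideanSpace ℝ (Fin d) →ₗ[ℝ] EuclideanSpace ℝ (Fin d)) := rfl
      rw [this, LinearMap.det_comp, h1, hSdet]; norm_num)
    refine ⟨ρ, ?_⟩
    rw [hρ, LinearIsometryEquiv.trans_apply, hT, hSξ]

theorem SO.continuous_toIsometryEquiv_apply (x : EuclideanSpace ℝ (Fin d)) :
    Continuous fun ρ : SO d => ρ.toIsometryEquiv x := by
  simp only [SO.toIsometryEquiv_apply, Matrix.toLpLin_apply]
  refine (PiLp.continuous_toLp 2 _).comp ?_
  exact continuous_subtype_val.matrix_mulVec continuous_const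

theorem periodization_ae_eq_zero_iff {f : EuclideanSpace ℝ (Fin d) → ℂ} (hf : Integrable f)
    (ρ : SO d) :
    periodization f ρ =ᵐ[volume] 0 ↔
      ∀ m : Fin d → ℤ, 𝓕 f (ρ.toIsometryEquiv (latticePoint m)) = 0 := by
  have hF : Integrable (f ∘ ρ.toIsometryEquiv) :=
    (ρ.toIsometryEquiv.measurePreserving.integrable_comp_emb
      ρ.toIsometryEquiv.toHomeomorph.measurableEmbedding).2 hf
  simp_rw [← Real.fourier_comp_linearIsometry]
  exact tsum_translate_ae_eq_zero_iff hF

theorem Real.continuous_fourier_of_integrable {V : Type*} [NormedAddCommGroup V]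
    [InnerProductSpace ℝ V] [FiniteDimensional ℝ V] [MeasurableSpace V] [BorelSpace V]
    {f : V → ℂ} (hf : Integrable f) : Continuous (𝓕 f) :=
  VectorFourier.fourierIntegral_continuous Real.continuous_fourierChar
    (by exact continuous_inner) hf

/-- The countable quantifier over `m` commutes with "almost every `ρ`". For fixed `m` a continuous
function of `ρ` that is zero almost everywhere for Haar measure is zero, and the orbit of `m` is its
sphere. -/
theorem hasVanishingPeriodizations_iff (hd : 2 ≤ d) {f : EuclideanSpace ℝ (Fin d) → ℂ}
    (hf : Integrable f) :
    HasVanishingPeriodizations f ↔ FourierVanishesOnLatticeSpheres f := by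
  simp only [HasVanishingPeriodizations, periodization_ae_eq_zero_iff hf, ae_all_iff]
  refine forall_congr' fun m => ?_
  constructor
  · intro h ξ hξ
    rw [mem_sphere_zero_iff_norm] at hξ
    have hc : Continuous fun ρ : SO d => 𝓕 f (ρ.toIsometryEquiv (latticePoint m)) :=
      (Real.continuous_fourier_of_integrable hf).comp (SO.continuous_toIsometryEquiv_apply _)
    have h0 := (Continuous.ae_eq_iff_eq (μ := (Measure.haar : Measure (SO d))) hc
      (continuous_const (y := (0 : ℂ)))).1 h
    obtain ⟨ρ, rfl⟩ := SO.exists_apply_eq hd hξ.symm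
    exact congrFun h0 ρ
  · intro h
    refine Filter.Eventually.of_forall fun ρ => h _ ?_
    rw [mem_sphere_zero_iff_norm, LinearIsometryEquiv.norm_map]

end Rotation

/-! ### Complex Gaussian flows and Poisson summation in `|ξ|²` -/

section Gaussian

variable {V : Type*} [NormedAddCommGroup V] [InnerProductSpace ℝ V] [FiniteDimensional ℝ V]
  [MeasurableSpace V] [BorelSpace V]

/-- The convolution of `f` with the Gaussian `z ^ (-n / 2) * exp (-π |x|² / z)`, for `0 ≤ re z`.
For `z = ε > 0` this is the heat flow, for `z = i s` the Schrödinger flow. -/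
noncomputable def gaussianConv (z : ℂ) (f : V → ℂ) (x : V) : ℂ :=
  (1 / z) ^ (Module.finrank ℝ V / 2 : ℂ) *
    ∫ y, Complex.exp (-Real.pi * ‖x - y‖ ^ 2 / z) * f y

theorem Complex.norm_exp_neg_pi_mul_sq_div_le_one {z : ℂ} (hz : 0 ≤ z.re) (r : ℝ) :
    ‖Complex.exp (-Real.pi * r ^ 2 / z)‖ ≤ 1 := by
  rw [Complex.norm_exp, Real.exp_le_one_iff]
  have h : (-Real.pi * r ^ 2 / z : ℂ) = ((-(Real.pi * r ^ 2) : ℝ) : ℂ) * z⁻¹ := by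
    push_cast; ring
  rw [h, Complex.re_ofReal_mul, Complex.inv_re]
  have : 0 ≤ z.re / Complex.normSq z := div_nonneg hz (Complex.normSq_nonneg z)
  nlinarith [mul_nonneg (mul_nonneg Real.pi_pos.le (sq_nonneg r)) this]

theorem norm_one_div_cpow_half (n : ℕ) (z : ℂ) :
    ‖(1 / z) ^ (n / 2 : ℂ)‖ = ‖z‖ ^ (-(n / 2 : ℝ)) := by
  have : (n / 2 : ℂ) = ((n / 2 : ℝ) : ℂ) := by push_cast; rfl
  rw [this, Complex.norm_cpow_real, norm_div, norm_one, one_div, Real.inv_rpow (norm_nonneg _),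
    Real.rpow_neg (norm_nonneg _)]

theorem norm_gaussianConv_le {z : ℂ} (hz : 0 ≤ z.re) {f : V → ℂ} (hf : Integrable f) (x : V) :
    ‖gaussianConv z f x‖ ≤ ‖z‖ ^ (-(Module.finrank ℝ V / 2 : ℝ)) * ∫ y, ‖f y‖ := by
  rw [gaussianConv, norm_mul, norm_one_div_cpow_half]
  gcongr
  refine norm_integral_le_of_norm_le hf.norm (Filter.Eventually.of_forall fun y => ?_)
  rw [norm_mul]
  exact mul_le_of_le_one_left (norm_nonneg _)
    (Complex.norm_exp_neg_pi_mul_sq_div_le_one hz _)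

/-- Moving the Fourier transform from `f` onto the Gaussian identifies `gaussianConv z` as the
multiplier `exp(-πz|ξ|²)`. Strict positivity of `re z` makes the Gaussian integrable; the
Schrödinger case is reached only as a limit. -/
theorem integral_gaussian_mul_fourier {z : ℂ} (hz : 0 < z.re) {f : V → ℂ} (hf : Integrable f)
    (x : V) :
    ∫ ξ : V, Complex.exp (-(Real.pi * z) * ‖ξ‖ ^ 2 + 2 * Real.pi * Complex.I * (inner ℝ x ξ : ℝ)) *
      𝓕 f ξ = gaussianConv z f x := by
  have hb : 0 < (Real.pi * z).re := by
    rw [Complex.re_ofReal_mul]; exact mul_pos Real.pi_pos hz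
  have hz0 : z ≠ 0 := by rintro rfl; simp at hz
  have hpi : (Real.pi : ℂ) ≠ 0 := Complex.ofReal_ne_zero.2 Real.pi_ne_zero
  have J : Integrable (fun w : V => Complex.exp (-(Real.pi * z) * ‖w‖ ^ 2 +
      2 * Real.pi * Complex.I * (inner ℝ x w : ℝ))) :=
    GaussianFourier.integrable_cexp_neg_mul_sq_norm_add hb _ _
  have key := (VectorFourier.integral_fourierIntegral_smul_eq_flip (L := innerₗ V)
      Real.continuous_fourierChar continuous_inner J hf)
  rw [flip_innerₗ] at key
  change ∫ w, 𝓕 (fun w : V => Complex.exp (-(Real.pi * z) * ‖w‖ ^ 2 +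
      2 * Real.pi * Complex.I * (inner ℝ x w : ℝ))) w • f w = ∫ w, _ • 𝓕 f w at key
  simp only [smul_eq_mul] at key
  rw [← key, gaussianConv, ← integral_const_mul]
  refine integral_congr_ae (Filter.Eventually.of_forall fun w => ?_)
  simp only
  rw [fourier_gaussian_innerProductSpace' hb, mul_assoc]
  congr 2
  · rw [← div_div, div_self hpi]
  · congr 1
    field_simp

theorem integral_eq_integral_Ioi_integral_sphere [Nontrivial V] {H : V → ℂ} (hH : Integrable H) :
    ∫ ξ, H ξ = ∫ r in Set.Ioi (0 : ℝ), ((r ^ (Module.finrank ℝ V - 1) : ℝ) : ℂ) *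
      ∫ ω : Metric.sphere (0 : V) 1, H (r • (ω : V)) ∂(volume : Measure V).toSphere := by
  have hmp := (volume : Measure V).measurePreserving_homeomorphUnitSphereProd
  have hemb := (homeomorphUnitSphereProd V).measurableEmbedding
  set G : Metric.sphere (0 : V) 1 × Set.Ioi (0 : ℝ) → ℂ := fun p => H ((p.2 : ℝ) • (p.1 : V))
    with hG
  have hGc : ∀ x : ({0}ᶜ : Set V), G (homeomorphUnitSphereProd V x) = H x := by
    intro x
    have := congrArg Subtype.val ((homeomorphUnitSphereProd V).symm_apply_apply x)
    rw [homeomorphUnitSphereProd_symm_apply_coe] at this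
    simp only [hG]
    rw [this]
  have hGint : Integrable G ((volume : Measure V).toSphere.prod
      (Measure.volumeIoiPow (Module.finrank ℝ V - 1))) := by
    rw [← hmp.integrable_comp_emb hemb]
    have : G ∘ (homeomorphUnitSphereProd V) = fun x : ({0}ᶜ : Set V) => H x := funext hGc
    rw [this]
    exact (integrableOn_iff_comap_subtypeVal (measurableSet_singleton _).compl).1 hH.integrableOn
  calc ∫ ξ, H ξ = ∫ x : ({(0)}ᶜ : Set V), H x
          ∂(volume.comap (Subtype.val : ({0}ᶜ : Set V) → V)) := by
        rw [integral_subtype_comap (measurableSet_singleton _).compl fun x ↦ H x,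
          restrict_compl_singleton]
    _ = ∫ p, G p ∂((volume : Measure V).toSphere.prod
          (Measure.volumeIoiPow (Module.finrank ℝ V - 1))) := by
        rw [← hmp.integral_comp hemb]
        simp_rw [hGc]
    _ = ∫ r : Set.Ioi (0 : ℝ), (∫ ω, G (ω, r) ∂(volume : Measure V).toSphere)
          ∂(Measure.volumeIoiPow (Module.finrank ℝ V - 1)) := integral_prod_symm _ hGint
    _ = _ := by
        simp only [Measure.volumeIoiPow, ENNReal.ofReal]
        rw [integral_withDensity_eq_integral_smul]
        · rw [integral_subtype_comap measurableSet_Ioi fun r : ℝ =>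
            Real.toNNReal (r ^ (Module.finrank ℝ V - 1)) •
              ∫ ω : Metric.sphere (0 : V) 1, H (r • (ω : V)) ∂(volume : Measure V).toSphere]
          refine setIntegral_congr_fun measurableSet_Ioi fun r hr => ?_
          rw [NNReal.smul_def, Real.coe_toNNReal _ (pow_nonneg (Set.mem_Ioi.1 hr).le _)]
          simp
        · exact (measurable_subtype_coe.pow_const _).real_toNNReal

/-- The density at `t = |ξ|²` of the push-forward of `G dξ` by `ξ ↦ |ξ|²`. -/
noncomputable def normSqDensity (G : V → ℂ) (t : ℝ) : ℂ :=
  ((1 / 2 * (max t 0) ^ (Module.finrank ℝ V / 2 - 1 : ℝ) : ℝ) : ℂ) *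
    ∫ ω : Metric.sphere (0 : V) 1, G (√t • (ω : V)) ∂(volume : Measure V).toSphere

/-- The exponent `d/2 - 1` is positive for `d ≥ 3`, so the density extends continuously by zero
across `t = 0`, as Poisson summation on the whole line requires. -/
theorem continuous_normSqDensity (hV : 3 ≤ Module.finrank ℝ V) {G : V → ℂ} (hG : Continuous G) :
    Continuous (normSqDensity G) := by
  have hV' : (3 : ℝ) ≤ Module.finrank ℝ V := by exact_mod_cast hV
  have h1 : Continuous fun t : ℝ => ∫ ω : Metric.sphere (0 : V) 1, G (√t • (ω : V))
      ∂(volume : Measure V).toSphere := by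
    have := continuous_parametric_integral_of_continuous (μ := (volume : Measure V).toSphere)
      (f := fun (t : ℝ) (ω : Metric.sphere (0 : V) 1) => G (√t • (ω : V)))
      (by unfold Function.uncurry; fun_prop) isCompact_univ
    simpa using this
  refine Continuous.mul (Complex.continuous_ofReal.comp (continuous_const.mul ?_)) h1
  exact (continuous_id.max continuous_const).rpow_const fun t => Or.inr (by linarith)

theorem normSqDensity_of_nonpos (hV : 3 ≤ Module.finrank ℝ V) (G : V → ℂ) {t : ℝ} (ht : t ≤ 0) :
    normSqDensity G t = 0 := by
  have hV' : (3 : ℝ) ≤ Module.finrank ℝ V := by exact_mod_cast hV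
  rw [normSqDensity, max_eq_right ht, Real.zero_rpow (by linarith)]
  simp

theorem normSqDensity_of_sphere_eq_zero {G : V → ℂ} {t : ℝ} (ht : 0 ≤ t)
    (h : ∀ ξ : V, ‖ξ‖ ^ 2 = t → G ξ = 0) : normSqDensity G t = 0 := by
  rw [normSqDensity]
  have : ∀ ω : Metric.sphere (0 : V) 1, G (√t • (ω : V)) = 0 := by
    intro ω
    refine h _ ?_
    rw [norm_smul, mul_pow, Real.norm_eq_abs, sq_abs, Real.sq_sqrt ht]
    have : ‖(ω : V)‖ = 1 := by simp
    rw [this]; ring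
  simp [this]

theorem integral_mul_normSqDensity (hV : 3 ≤ Module.finrank ℝ V) {G : V → ℂ} {u : ℝ → ℂ}
    (hG : Integrable fun ξ => u (‖ξ‖ ^ 2) * G ξ) :
    ∫ t, u t * normSqDensity G t = ∫ ξ, u (‖ξ‖ ^ 2) * G ξ := by
  have : Nontrivial V := Module.nontrivial_of_finrank_pos (R := ℝ) (by omega)
  rw [integral_eq_integral_Ioi_integral_sphere hG,
    ← setIntegral_eq_integral_of_forall_compl_eq_zero (s := Set.Ioi (0 : ℝ)),
    ← integral_comp_rpow_Ioi_of_pos two_pos]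
  · refine setIntegral_congr_fun measurableSet_Ioi fun r hr => ?_
    have hr0 : 0 < r := hr
    have hsq : r ^ (2 : ℝ) = r ^ 2 := by norm_cast
    have hsphere : ∀ ω : Metric.sphere (0 : V) 1, ‖r • (ω : V)‖ ^ 2 = r ^ 2 := by
      intro ω
      have : ‖(ω : V)‖ = 1 := by simp
      rw [norm_smul, this, mul_one, Real.norm_eq_abs, sq_abs]
    simp only [hsphere]
    rw [normSqDensity, hsq, Real.sqrt_sq hr0.le, max_eq_left (sq_nonneg r), integral_const_mul,
      Complex.real_smul]
    -- Jacobian of `t = r²`: the factor `½ t^(d/2 - 1) dt` becomes `r^(d-1) dr`.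
    have hpow : 2 * r ^ (2 - 1 : ℝ) * (1 / 2 * (r ^ 2) ^ (Module.finrank ℝ V / 2 - 1 : ℝ)) =
        r ^ (Module.finrank ℝ V - 1) := by
      rw [← hsq, ← Real.rpow_mul hr0.le, ← Real.rpow_natCast, Nat.cast_sub (by omega)]
      have : (2 : ℝ) * r ^ (2 - 1 : ℝ) * (1 / 2 * r ^ (2 * (Module.finrank ℝ V / 2 - 1 : ℝ))) =
        r ^ (2 - 1 : ℝ) * r ^ (2 * (Module.finrank ℝ V / 2 - 1 : ℝ)) := by ring
      rw [this, ← Real.rpow_add hr0]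
      congr 1
      push_cast
      ring
    rw [← hpow]
    push_cast
    ring
  · intro t ht
    rw [normSqDensity_of_nonpos hV G (not_lt.1 ht), mul_zero]

theorem norm_normSqDensity_le {G : V → ℂ} {B ε t : ℝ} (ht : 0 ≤ t)
    (hG : ∀ ξ, ‖G ξ‖ ≤ B * Real.exp (-ε * ‖ξ‖ ^ 2)) :
    ‖normSqDensity G t‖ ≤ 1 / 2 * t ^ (Module.finrank ℝ V / 2 - 1 : ℝ) *
      (B * Real.exp (-ε * t) * (volume : Measure V).toSphere.real Set.univ) := by
  rw [normSqDensity, norm_mul, max_eq_left ht, Complex.norm_real,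
    Real.norm_of_nonneg (by positivity)]
  gcongr
  refine norm_integral_le_of_norm_le_const (Filter.Eventually.of_forall fun ω => ?_)
  have h : ‖√t • (ω : V)‖ ^ 2 = t := by
    have : ‖(ω : V)‖ = 1 := by simp
    rw [norm_smul, this, mul_one, Real.norm_eq_abs, sq_abs, Real.sq_sqrt ht]
  simpa only [h] using hG (√t • (ω : V))

theorem normSqDensity_isBigO (hV : 3 ≤ Module.finrank ℝ V) {G : V → ℂ} {B ε : ℝ} (hε : 0 < ε)
    (hG : ∀ ξ, ‖G ξ‖ ≤ B * Real.exp (-ε * ‖ξ‖ ^ 2)) :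
    (normSqDensity G) =O[Filter.cocompact ℝ] fun t : ℝ => |t| ^ (-2 : ℝ) := by
  rw [cocompact_eq_atBot_atTop, Asymptotics.isBigO_sup]
  constructor
  · refine (Asymptotics.isBigO_zero _ _).congr' ?_ Filter.EventuallyEq.rfl
    filter_upwards [Filter.eventually_le_atBot 0] with t ht
    exact (normSqDensity_of_nonpos hV G ht).symm
  · have h1 := (isLittleO_exp_neg_mul_rpow_atTop hε
      (-2 - (Module.finrank ℝ V / 2 - 1 : ℝ))).isBigO
    have h2 := (Asymptotics.isBigO_refl
      (fun t : ℝ => t ^ (Module.finrank ℝ V / 2 - 1 : ℝ)) Filter.atTop).mul h1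
    have h3 : (fun t : ℝ => t ^ (Module.finrank ℝ V / 2 - 1 : ℝ) *
        t ^ (-2 - (Module.finrank ℝ V / 2 - 1 : ℝ))) =ᶠ[Filter.atTop]
        fun t : ℝ => |t| ^ (-2 : ℝ) := by
      filter_upwards [Filter.eventually_gt_atTop 0] with t ht
      rw [← Real.rpow_add ht, abs_of_pos ht]
      congr 1
      ring
    refine Asymptotics.IsBigO.trans ?_ (h2.trans_eventuallyEq h3)
    refine Asymptotics.IsBigO.of_bound
      (1 / 2 * (B * (volume : Measure V).toSphere.real Set.univ)) ?_
    filter_upwards [Filter.eventually_ge_atTop 0] with t ht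
    refine (norm_normSqDensity_le ht hG).trans (le_of_eq ?_)
    rw [Real.norm_of_nonneg (by positivity)]
    ring

theorem norm_fourier_le_integral_norm (f : V → ℂ) (ξ : V) : ‖𝓕 f ξ‖ ≤ ∫ y, ‖f y‖ :=
  VectorFourier.norm_fourierIntegral_le_integral_norm _ _ _ _ _

theorem norm_gaussianConv_add_mul_I_le {ε s : ℝ} (hε : 0 ≤ ε) (hs : s ≠ 0) {f : V → ℂ}
    (hf : Integrable f) (x : V) :
    ‖gaussianConv (ε + s * Complex.I) f x‖ ≤
      |s| ^ (-(Module.finrank ℝ V / 2 : ℝ)) * ∫ y, ‖f y‖ := by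
  refine (norm_gaussianConv_le (by simpa using hε) hf x).trans ?_
  gcongr ?_ * _
  refine Real.rpow_le_rpow_of_nonpos (abs_pos.2 hs) ?_ (neg_nonpos.2 (by positivity))
  simpa using Complex.abs_im_le_norm (ε + s * Complex.I)

theorem summable_abs_div_four_rpow {b : ℝ} (hb : 1 < b) :
    Summable fun k : ℤ => |(k / 4 : ℝ)| ^ (-b) := by
  refine ((Real.summable_abs_int_rpow hb).mul_right ((4 : ℝ) ^ (-b))⁻¹).congr fun k => ?_
  rw [abs_div, Real.div_rpow (abs_nonneg _) (abs_nonneg _), abs_of_pos (by norm_num : (0 : ℝ) < 4),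
    div_eq_mul_inv]

theorem summable_norm_gaussianConv (hV : 3 ≤ Module.finrank ℝ V) {ε : ℝ} (hε : 0 ≤ ε) {f : V → ℂ}
    (hf : Integrable f) (x : V) :
    Summable fun k : ℤ => ‖gaussianConv (ε + (k / 4 : ℝ) * Complex.I) f x‖ := by
  have hV' : (3 : ℝ) ≤ Module.finrank ℝ V := by exact_mod_cast hV
  refine Summable.of_norm_bounded_eventually ((summable_abs_div_four_rpow
    (b := Module.finrank ℝ V / 2) (by linarith)).mul_right (∫ y, ‖f y‖)) ?_
  filter_upwards [(Set.finite_singleton (0 : ℤ)).compl_mem_cofinite] with k hk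
  have hk0 : (k / 4 : ℝ) ≠ 0 := by
    have : (k : ℝ) ≠ 0 := by exact_mod_cast hk
    positivity
  simpa using norm_gaussianConv_add_mul_I_le hε hk0 hf x

/-- If `𝓕 f` vanishes on the spheres `|ξ|² = 8 j + 3`, Poisson summation in the variable `|ξ|²`
gives a linear relation between the Gaussian convolutions of `f`. -/
theorem tsum_gaussianConv_mul_fourier_eq_zero (hV : 3 ≤ Module.finrank ℝ V) {f : V → ℂ}
    (hf : Integrable f) (h : ∀ (j : ℕ) (ξ : V), ‖ξ‖ ^ 2 = 8 * j + 3 → 𝓕 f ξ = 0) {ε : ℝ}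
    (hε : 0 < ε) (x : V) :
    ∑' k : ℤ, gaussianConv (ε + (k / 4 : ℝ) * Complex.I) f x *
      fourier k ((3 / 8 : ℝ) : UnitAddCircle) = 0 := by
  set G : V → ℂ := fun ξ => Complex.exp (-(Real.pi * ε) * ‖ξ‖ ^ 2 +
    2 * Real.pi * Complex.I * (inner ℝ x ξ : ℝ)) * 𝓕 f ξ with hGdef
  have hGc : Continuous G := by
    have := Real.continuous_fourier_of_integrable hf
    fun_prop
  have hGb : ∀ ξ, ‖G ξ‖ ≤ (∫ y, ‖f y‖) * Real.exp (-(Real.pi * ε) * ‖ξ‖ ^ 2) := by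
    intro ξ
    rw [hGdef, norm_mul, mul_comm, Complex.norm_exp]
    refine mul_le_mul (norm_fourier_le_integral_norm f ξ) (le_of_eq ?_) (Real.exp_pos _).le
      (by positivity)
    congr 1
    simp [← Complex.ofReal_pow, ← Complex.ofReal_mul]
  have hGdec := normSqDensity_isBigO hV (mul_pos Real.pi_pos hε) hGb
  -- The rescaling by `8` carries the progression `8n + 3` to the translated integers `3/8 + n`.
  set g : ℝ → ℂ := fun t => normSqDensity G (8 * t) with hg
  have hgc : Continuous g :=
    (continuous_normSqDensity hV hGc).comp (continuous_const.mul continuous_id)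
  have hgdec : g =O[Filter.cocompact ℝ] fun t : ℝ => |t| ^ (-2 : ℝ) := by
    have h1 : Filter.Tendsto (fun t : ℝ => 8 * t) (Filter.cocompact ℝ) (Filter.cocompact ℝ) :=
      (Homeomorph.mulLeft₀ (8 : ℝ) (by norm_num)).isClosedEmbedding.tendsto_cocompact
    refine (hGdec.comp_tendsto h1).trans (Asymptotics.IsBigO.of_bound ((8 : ℝ) ^ (-2 : ℝ)) ?_)
    refine Filter.Eventually.of_forall fun t => ?_
    simp only [Function.comp]
    rw [abs_mul, abs_of_pos (by norm_num : (0 : ℝ) < 8), Real.mul_rpow (by norm_num) (abs_nonneg t),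
      norm_mul, Real.norm_of_nonneg (by positivity)]
  -- The phase `exp(-2πi k|ξ|²/8)` equals `exp(-π(ik/4)|ξ|²)`, which is the origin of the times
  -- `k/4`; `1/8` is the Jacobian.
  have hFg : ∀ k : ℤ, 𝓕 g k = (1 / 8) * gaussianConv (ε + (k / 4 : ℝ) * Complex.I) f x := by
    intro k
    have hre : 0 < (ε + (k / 4 : ℝ) * Complex.I : ℂ).re := by simpa using hε
    rw [Real.fourier_real_eq_integral_exp_smul, ← integral_gaussian_mul_fourier hre hf]
    set K : ℝ → ℂ := fun s => Complex.exp ((-2 * Real.pi * s * (k / 8) : ℝ) * Complex.I) *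
      normSqDensity G s with hK
    have e1 : ∀ t : ℝ, Complex.exp ((-2 * Real.pi * t * k : ℝ) * Complex.I) • g t =
        K (8 * t) := by
      intro t
      simp only [hg, hK, smul_eq_mul]
      congr 4
      ring
    simp_rw [e1]
    rw [Measure.integral_comp_mul_left K 8, hK, integral_mul_normSqDensity hV
      (u := fun s : ℝ => Complex.exp ((-2 * Real.pi * s * (k / 8) : ℝ) * Complex.I))]
    · rw [Complex.real_smul, abs_of_pos (by norm_num)]
      congr 1
      · push_cast; ring
      · refine integral_congr_ae (Filter.Eventually.of_forall fun ξ => ?_)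
        simp only [hGdef]
        rw [← mul_assoc, ← Complex.exp_add]
        congr 2
        push_cast
        ring
    · have hGi : Integrable G := by
        have := (GaussianFourier.integrable_cexp_neg_mul_sq_norm_add (V := V)
          (b := (Real.pi * ε : ℂ)) (by rw [← Complex.ofReal_mul]; exact mul_pos Real.pi_pos hε)
          0 0)
        refine (this.norm.const_mul (∫ y, ‖f y‖)).mono' hGc.aestronglyMeasurable
          (Filter.Eventually.of_forall fun ξ => (hGb ξ).trans (le_of_eq ?_))
        rw [Complex.norm_exp]
        congr 2
        simp [← Complex.ofReal_pow, ← Complex.ofReal_mul]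
      refine hGi.bdd_mul (c := 1) (Continuous.aestronglyMeasurable (by fun_prop))
        (Filter.Eventually.of_forall fun ξ => le_of_eq ?_)
      rw [Complex.norm_exp_ofReal_mul_I]
  have hFsum : Summable fun k : ℤ => 𝓕 g k := by
    simp_rw [hFg]
    exact (summable_norm_gaussianConv hV hε.le hf x).of_norm.mul_left _
  have hP := Real.tsum_eq_tsum_fourier_of_rpow_decay_of_summable hgc one_lt_two hgdec hFsum (3 / 8)
  -- For `n ≥ 0` the point lies on a sphere where `𝓕 f` vanishes; for `n < 0` it lies on the
  -- negative axis, outside the support of the density.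
  have hz : ∀ n : ℤ, g (3 / 8 + n) = 0 := by
    intro n
    have e : (8 * (3 / 8 + n) : ℝ) = 8 * n + 3 := by ring
    simp only [hg, e]
    rcases le_or_gt 0 n with hn | hn
    · obtain ⟨j, rfl⟩ := Int.eq_ofNat_of_zero_le hn
      refine normSqDensity_of_sphere_eq_zero (by positivity) fun ξ hξ => ?_
      rw [hGdef]
      simp only
      rw [h j ξ (by simpa using hξ), mul_zero]
    · refine normSqDensity_of_nonpos hV G ?_
      have : (n : ℝ) ≤ -1 := by exact_mod_cast (by omega : n ≤ -1)
      linarith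
  simp_rw [hz, tsum_zero, hFg, mul_assoc, tsum_mul_left] at hP
  simpa using hP.symm

end Gaussian

/-! ### Passing to the limit: `f` as a sum of Schrödinger evolutions -/

section SchrodingerExpansion

variable {V : Type*} [NormedAddCommGroup V] [InnerProductSpace ℝ V] [FiniteDimensional ℝ V]
  [MeasurableSpace V] [BorelSpace V]

open Filter Topology

theorem continuous_gaussianConv {z : ℂ} (hz : 0 ≤ z.re) {f : V → ℂ} (hf : Integrable f) :
    Continuous (gaussianConv z f) := by
  unfold gaussianConv
  refine continuous_const.mul (continuous_of_dominated (bound := fun y => ‖f y‖) ?_ ?_ hf.norm ?_)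
  · intro x
    exact (Continuous.aestronglyMeasurable (by fun_prop)).mul hf.aestronglyMeasurable
  · intro x
    refine Eventually.of_forall fun y => ?_
    rw [norm_mul]
    exact mul_le_of_le_one_left (norm_nonneg _)
      (Complex.norm_exp_neg_pi_mul_sq_div_le_one hz _)
  · exact Eventually.of_forall fun y => by fun_prop

theorem tendsto_gaussianConv_add_mul_I {s : ℝ} (hs : s ≠ 0) {f : V → ℂ} (hf : Integrable f)
    (x : V) :
    Tendsto (fun ε : ℝ => gaussianConv (ε + s * Complex.I) f x) (𝓝[>] 0)
      (𝓝 (gaussianConv (s * Complex.I) f x)) := by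
  have hsI : (s : ℂ) * Complex.I ≠ 0 := mul_ne_zero (by exact_mod_cast hs) Complex.I_ne_zero
  have hlin : Tendsto (fun ε : ℝ => (ε : ℂ) + s * Complex.I) (𝓝[>] 0) (𝓝 (s * Complex.I)) := by
    have : Continuous fun ε : ℝ => (ε : ℂ) + s * Complex.I := by fun_prop
    have h := (this.tendsto 0).mono_left (nhdsWithin_le_nhds (s := Set.Ioi 0))
    simpa using h
  unfold gaussianConv
  refine Tendsto.mul ?_ ?_
  · have hdiv : Tendsto (fun ε : ℝ => 1 / ((ε : ℂ) + s * Complex.I)) (𝓝[>] 0)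
        (𝓝 (1 / (s * Complex.I))) := tendsto_const_nhds.div hlin hsI
    -- `1/(is)` is purely imaginary and nonzero, hence off the branch cut of the power.
    refine (continuousAt_cpow_const ?_).tendsto.comp hdiv
    refine Complex.mem_slitPlane_iff.2 (Or.inr ?_)
    simp [hs]
  · refine tendsto_integral_filter_of_dominated_convergence (fun y => ‖f y‖) ?_ ?_ hf.norm ?_
    · exact Eventually.of_forall fun ε =>
        (Continuous.aestronglyMeasurable (by fun_prop)).mul hf.aestronglyMeasurable
    · filter_upwards [self_mem_nhdsWithin] with ε hε
      refine Eventually.of_forall fun y => ?_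
      rw [norm_mul]
      exact mul_le_of_le_one_left (norm_nonneg _)
        (Complex.norm_exp_neg_pi_mul_sq_div_le_one (by simpa using (Set.mem_Ioi.1 hε).le) _)
    · refine Eventually.of_forall fun y => Tendsto.mul_const _ ?_
      exact (tendsto_const_nhds.div hlin hsI).cexp

theorem norm_exp_neg_pi_mul_sq_div_ofReal (ε r : ℝ) :
    ‖Complex.exp (-Real.pi * r ^ 2 / (ε : ℂ))‖ = Real.exp (-(Real.pi / ε) * r ^ 2) := by
  rw [Complex.norm_exp]
  congr 1
  have : (-Real.pi * r ^ 2 / (ε : ℂ) : ℂ) =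
    ((-(Real.pi / ε) * r ^ 2 : ℝ) : ℂ) := by push_cast; ring
  rw [this, Complex.ofReal_re]

theorem integrable_rexp_neg_mul_sq_norm {b : ℝ} (hb : 0 < b) :
    Integrable fun y : V => Real.exp (-b * ‖y‖ ^ 2) := by
  by_contra h
  have h2 := GaussianFourier.integral_rexp_neg_mul_sq_norm (V := V) hb
  rw [integral_undef h] at h2
  exact absurd h2 (by positivity)

/-- The heat kernel, normalized to have integral `1`. -/
noncomputable def heatKernel (ε : ℝ) (x : V) : ℝ :=
  ε ^ (-(Module.finrank ℝ V / 2 : ℝ)) * Real.exp (-(Real.pi / ε) * ‖x‖ ^ 2)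

theorem heatKernel_nonneg {ε : ℝ} (hε : 0 ≤ ε) (x : V) : 0 ≤ heatKernel ε x := by
  unfold heatKernel; positivity

theorem continuous_heatKernel (ε : ℝ) : Continuous (heatKernel ε : V → ℝ) := by
  unfold heatKernel; fun_prop

theorem integrable_heatKernel {ε : ℝ} (hε : 0 < ε) : Integrable (heatKernel ε : V → ℝ) :=
  (integrable_rexp_neg_mul_sq_norm (div_pos Real.pi_pos hε)).const_mul _

theorem integral_heatKernel {ε : ℝ} (hε : 0 < ε) : ∫ x : V, heatKernel ε x = 1 := by
  simp only [heatKernel]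
  rw [integral_const_mul, GaussianFourier.integral_rexp_neg_mul_sq_norm (div_pos Real.pi_pos hε),
    div_div_cancel₀ Real.pi_ne_zero, ← Real.rpow_add hε]
  simp

theorem lintegral_heatKernel {ε : ℝ} (hε : 0 < ε) :
    ∫⁻ y : V, ENNReal.ofReal (heatKernel ε y) = 1 := by
  rw [← ofReal_integral_eq_lintegral_ofReal (integrable_heatKernel hε)
      (Eventually.of_forall (heatKernel_nonneg hε.le)), integral_heatKernel hε, ENNReal.ofReal_one]

theorem norm_gaussianConv_ofReal_le {ε : ℝ} (hε : 0 < ε) {φ : V → ℂ} {B : ℝ}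
    (hB : ∀ x, ‖φ x‖ ≤ B) (x : V) : ‖gaussianConv (ε : ℂ) φ x‖ ≤ B := by
  rw [gaussianConv, ← integral_const_mul]
  refine (norm_integral_le_of_norm_le (((integrable_heatKernel hε).comp_sub_left x).mul_const B)
    (Eventually.of_forall fun y => ?_)).trans (le_of_eq ?_)
  · rw [← mul_assoc, norm_mul, norm_mul, norm_one_div_cpow_half, norm_exp_neg_pi_mul_sq_div_ofReal,
      Complex.norm_real, Real.norm_of_nonneg hε.le, heatKernel]
    gcongr
    exact hB y
  · rw [integral_mul_const, integral_sub_left_eq_self (heatKernel ε), integral_heatKernel hε,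
      one_mul]

/-- With `ε = 1/(πc)` the heat kernel is the Gaussian approximate identity with parameter `c → ∞`.
-/
theorem tendsto_gaussianConv_ofReal {φ : V → ℂ} (hφ : Integrable φ) (hc : Continuous φ) (x : V) :
    Tendsto (fun c : ℝ => gaussianConv (((Real.pi * c)⁻¹ : ℝ) : ℂ) φ x) atTop (𝓝 (φ x)) := by
  refine (Real.tendsto_integral_gaussian_smul' hφ hc.continuousAt).congr' ?_
  filter_upwards [eventually_gt_atTop 0] with c hc0
  rw [gaussianConv, ← integral_const_mul]
  refine integral_congr_ae (Eventually.of_forall fun y => ?_)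
  simp only [smul_eq_mul]
  rw [mul_assoc]
  push_cast
  rw [one_div, inv_inv, div_inv_eq_mul]
  congr 3
  ring

/-- The kernel is symmetric in `x` and `y`. This lets the heat flow act on a continuous test
function instead of on `f`, where its limit is pointwise. -/
theorem integral_mul_gaussianConv_comm {z : ℂ} (hz : 0 ≤ z.re) {f φ : V → ℂ} (hf : Integrable f)
    (hφ : Integrable φ) :
    ∫ x, φ x * gaussianConv z f x = ∫ y, f y * gaussianConv z φ y := by
  have hint : Integrable (Function.uncurry fun (x : V) (y : V) =>
      Complex.exp (-Real.pi * ‖x - y‖ ^ 2 / z) * (φ x * f y)) (volume.prod volume) := by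
    have := (hφ.mul_prod hf).bdd_mul (c := 1)
      (f := fun p : V × V => Complex.exp (-Real.pi * ‖p.1 - p.2‖ ^ 2 / z))
      (Continuous.aestronglyMeasurable (by fun_prop)) (Eventually.of_forall fun p =>
        Complex.norm_exp_neg_pi_mul_sq_div_le_one hz _)
    exact this
  have h1 := integral_integral_swap hint
  simp only [gaussianConv]
  calc _ = (1 / z) ^ (Module.finrank ℝ V / 2 : ℂ) *
        ∫ x, ∫ y, Complex.exp (-Real.pi * ‖x - y‖ ^ 2 / z) * (φ x * f y) := by
        rw [← integral_const_mul]
        refine integral_congr_ae (Eventually.of_forall fun x => ?_)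
        simp only
        rw [mul_left_comm, ← integral_const_mul]
        congr 2
        funext y
        ring
    _ = _ := by
        rw [h1, ← integral_const_mul]
        refine integral_congr_ae (Eventually.of_forall fun y => ?_)
        simp only
        rw [mul_left_comm, ← integral_const_mul (f y)]
        congr 2
        funext x
        rw [norm_sub_rev]
        ring

/-- The sum of the Schrödinger evolutions of `f` at the nonzero times `k / 4`, with the
characters of the residue class `3` modulo `8` as coefficients. -/
noncomputable def schrodingerSum (f : V → ℂ) (x : V) : ℂ :=
  ∑' k : ℤ, gaussianConv ((k / 4 : ℝ) * Complex.I) f x * fourier k ((3 / 8 : ℝ) : UnitAddCircle)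

theorem norm_mul_fourier_coe (w : ℂ) (k : ℤ) (t : UnitAddCircle) : ‖w * fourier k t‖ = ‖w‖ := by
  rw [norm_mul, fourier_apply, Circle.norm_coe, mul_one]

/-- Here `1/0 = 0` and `0^(d/2) = 0`, so the term `k = 0` of `schrodingerSum` drops out by itself.
-/
theorem gaussianConv_zero (hV : Module.finrank ℝ V ≠ 0) (f : V → ℂ) (x : V) :
    gaussianConv 0 f x = 0 := by
  rw [gaussianConv, div_zero, Complex.zero_cpow (by simpa using hV), zero_mul]

theorem norm_gaussianConv_mul_I_le (hV : Module.finrank ℝ V ≠ 0) (s : ℝ) {f : V → ℂ}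
    (hf : Integrable f) (x : V) :
    ‖gaussianConv (s * Complex.I) f x‖ ≤
      |s| ^ (-(Module.finrank ℝ V / 2 : ℝ)) * ∫ y, ‖f y‖ := by
  rcases eq_or_ne s 0 with rfl | hs
  · simp only [Complex.ofReal_zero, zero_mul, gaussianConv_zero hV, norm_zero]
    positivity
  · simpa using norm_gaussianConv_add_mul_I_le le_rfl hs hf x

theorem continuous_schrodingerSum (hV : 3 ≤ Module.finrank ℝ V) {f : V → ℂ}
    (hf : Integrable f) : Continuous (schrodingerSum f) := by
  have hV' : (3 : ℝ) ≤ Module.finrank ℝ V := by exact_mod_cast hV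
  refine continuous_tsum (fun k => (continuous_gaussianConv (by simp) hf).mul continuous_const)
    ((summable_abs_div_four_rpow (b := Module.finrank ℝ V / 2) (by linarith)).mul_right
      (∫ y, ‖f y‖)) fun k x => ?_
  rw [norm_mul_fourier_coe]
  exact norm_gaussianConv_mul_I_le (by omega) _ hf x

/-- If `𝓕 f` vanishes on the spheres `|ξ|² = 8 j + 3`, then `f` is minus the sum of its
Schrödinger evolutions at the nonzero times `k / 4`. -/
theorem ae_eq_neg_schrodingerSum (hV : 3 ≤ Module.finrank ℝ V) {f : V → ℂ}
    (hf : Integrable f) (h : ∀ (j : ℕ) (ξ : V), ‖ξ‖ ^ 2 = 8 * j + 3 → 𝓕 f ξ = 0) :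
    f =ᵐ[volume] fun x => -schrodingerSum f x := by
  have hV' : (3 : ℝ) ≤ Module.finrank ℝ V := by exact_mod_cast hV
  have hsum := (summable_abs_div_four_rpow (b := Module.finrank ℝ V / 2) (by linarith)).mul_right
      (∫ y, ‖f y‖)
  set T : ℝ → V → ℂ := fun ε x => ∑' k : ℤ, if k = 0 then 0 else
    gaussianConv (ε + (k / 4 : ℝ) * Complex.I) f x * fourier k ((3 / 8 : ℝ) : UnitAddCircle)
    with hT
  have hterm : ∀ {ε : ℝ}, 0 < ε → ∀ (x : V) (k : ℤ), ‖if k = 0 then 0 else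
      gaussianConv (ε + (k / 4 : ℝ) * Complex.I) f x * fourier k ((3 / 8 : ℝ) : UnitAddCircle)‖ ≤
      |(k / 4 : ℝ)| ^ (-(Module.finrank ℝ V / 2 : ℝ)) * ∫ y, ‖f y‖ := by
    intro ε hε x k
    split_ifs with hk
    · rw [norm_zero]; positivity
    · rw [norm_mul_fourier_coe]
      exact norm_gaussianConv_add_mul_I_le hε.le
        (div_ne_zero (by exact_mod_cast hk) four_ne_zero) hf x
  -- Isolating `k = 0` in the Poisson relation leaves the heat flow of `f` on one side.
  have hA : ∀ {ε : ℝ}, 0 < ε → ∀ x, gaussianConv (ε : ℂ) f x = -T ε x := by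
    intro ε hε x
    have h0 := tsum_gaussianConv_mul_fourier_eq_zero hV hf h hε x
    have hs : Summable fun k : ℤ => gaussianConv (ε + (k / 4 : ℝ) * Complex.I) f x *
        fourier k ((3 / 8 : ℝ) : UnitAddCircle) :=
      Summable.of_norm (by
        simp_rw [norm_mul_fourier_coe]
        exact summable_norm_gaussianConv hV hε.le hf x)
    rw [hs.tsum_eq_add_tsum_ite 0] at h0
    rw [eq_neg_iff_add_eq_zero, ← h0]
    congr 1
    simp
  have hTlim : ∀ x, Tendsto (fun ε => T ε x) (𝓝[>] 0) (𝓝 (schrodingerSum f x)) := by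
    intro x
    refine tendsto_tsum_of_dominated_convergence hsum (fun k => ?_) ?_
    · rcases eq_or_ne k 0 with rfl | hk
      · simp [gaussianConv_zero (V := V) (by omega)]
      · simp only [hk, if_false]
        exact (tendsto_gaussianConv_add_mul_I
          (div_ne_zero (by exact_mod_cast hk) four_ne_zero) hf x).mul_const _
    · filter_upwards [self_mem_nhdsWithin] with ε hε k using hterm hε x k
  have hε : Tendsto (fun c : ℝ => (Real.pi * c)⁻¹) atTop (𝓝[>] 0) :=
    tendsto_inv_atTop_nhdsGT_zero.comp (tendsto_id.const_mul_atTop Real.pi_pos)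
  have hcont := continuous_schrodingerSum hV hf
  -- The identity is tested against bump functions. The pairing of `φ` with the heat flow of `f` has
  -- two limits: `l1` through the relation `hA`, and `l2` by moving the flow onto `φ`.
  have key : ∀ᵐ x, f x + schrodingerSum f x = 0 := by
    refine ae_eq_zero_of_integral_contDiff_smul_eq_zero
      (hf.locallyIntegrable.add hcont.locallyIntegrable) fun g hg hgc => ?_
    set φ : V → ℂ := fun x => (g x : ℂ) with hφ
    have hφc : Continuous φ := Complex.continuous_ofReal.comp hg.continuous
    have hφs : HasCompactSupport φ := hgc.comp_left (g := ((↑) : ℝ → ℂ)) rfl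
    have hφi : Integrable φ := hφc.integrable_of_hasCompactSupport hφs
    obtain ⟨B, hB⟩ := hφs.exists_bound_of_continuous hφc
    have l1 : Tendsto (fun c : ℝ => ∫ x, φ x * gaussianConv (((Real.pi * c)⁻¹ : ℝ) : ℂ) f x) atTop
        (𝓝 (∫ x, φ x * -schrodingerSum f x)) := by
      refine tendsto_integral_filter_of_dominated_convergence (fun x => ‖φ x‖ *
        (∑' k : ℤ, |(k / 4 : ℝ)| ^ (-(Module.finrank ℝ V / 2 : ℝ)) * ∫ y, ‖f y‖)) ?_ ?_
        (hφi.norm.mul_const _) ?_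
      · filter_upwards [eventually_gt_atTop 0] with c hc
        exact hφc.aestronglyMeasurable.mul
          (continuous_gaussianConv (by rw [Complex.ofReal_re]; positivity)
            hf).aestronglyMeasurable
      · filter_upwards [eventually_gt_atTop 0] with c hc
        have hc' : 0 < (Real.pi * c)⁻¹ := by positivity
        refine Eventually.of_forall fun x => ?_
        rw [norm_mul, hA hc', norm_neg]
        gcongr
        exact tsum_of_norm_bounded hsum.hasSum (hterm hc' x)
      · refine Eventually.of_forall fun x => Tendsto.const_mul _ ?_
        refine ((hTlim x).neg.comp hε).congr' ?_
        filter_upwards [eventually_gt_atTop 0] with c hc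
        rw [hA (by positivity)]
        rfl
    have l2 : Tendsto (fun c : ℝ => ∫ x, φ x * gaussianConv (((Real.pi * c)⁻¹ : ℝ) : ℂ) f x) atTop
        (𝓝 (∫ y, f y * φ y)) := by
      have : Tendsto (fun c : ℝ => ∫ y, f y * gaussianConv (((Real.pi * c)⁻¹ : ℝ) : ℂ) φ y) atTop
          (𝓝 (∫ y, f y * φ y)) := by
        refine tendsto_integral_filter_of_dominated_convergence (fun y => ‖f y‖ * B) ?_ ?_
          (hf.norm.mul_const _) ?_
        · filter_upwards [eventually_gt_atTop 0] with c hc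
          exact hf.aestronglyMeasurable.mul
            (continuous_gaussianConv (by rw [Complex.ofReal_re]; positivity)
              hφi).aestronglyMeasurable
        · filter_upwards [eventually_gt_atTop 0] with c hc
          refine Eventually.of_forall fun x => ?_
          rw [norm_mul]
          gcongr
          exact norm_gaussianConv_ofReal_le (by positivity) hB x
        · exact Eventually.of_forall fun y =>
            (tendsto_gaussianConv_ofReal hφi hφc y).const_mul _
      refine this.congr' ?_
      filter_upwards [eventually_gt_atTop 0] with c hc
      exact (integral_mul_gaussianConv_comm (by rw [Complex.ofReal_re]; positivity) hf hφi).symm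
    have hlim := tendsto_nhds_unique l1 l2
    have i1 : Integrable fun x => f x * φ x :=
      hf.mul_bdd (c := B) hφc.aestronglyMeasurable (Eventually.of_forall hB)
    have i2 : Integrable fun x => φ x * -schrodingerSum f x :=
      (hφc.mul hcont.neg).integrable_of_hasCompactSupport hφs.mul_right
    calc ∫ x, g x • (f x + schrodingerSum f x) =
          ∫ x, (f x * φ x - φ x * -schrodingerSum f x) := by
          refine integral_congr_ae (Eventually.of_forall fun x => ?_)
          simp only [hφ, Complex.real_smul]
          ring
      _ = 0 := by rw [integral_sub i1 i2, hlim, sub_self]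
  filter_upwards [key] with x hx
  exact eq_neg_of_add_eq_zero_left hx

end SchrodingerExpansion

/-! ### Plancherel's inequality -/

section HausdorffYoung

variable {V : Type*} [NormedAddCommGroup V] [InnerProductSpace ℝ V] [FiniteDimensional ℝ V]
  [MeasurableSpace V] [BorelSpace V]

open Filter Topology

theorem enorm_gaussianConv_ofReal_le {ε : ℝ} (hε : 0 < ε) (f : V → ℂ) (x : V) :
    ‖gaussianConv (ε : ℂ) f x‖ₑ ≤ ∫⁻ y, ENNReal.ofReal (heatKernel ε (x - y)) * ‖f y‖ₑ := by
  rw [gaussianConv, ← integral_const_mul]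
  refine (enorm_integral_le_lintegral_enorm _).trans (lintegral_mono fun y => le_of_eq ?_)
  rw [← mul_assoc, enorm_mul, ← ofReal_norm, norm_mul, norm_one_div_cpow_half,
    norm_exp_neg_pi_mul_sq_div_ofReal, Complex.norm_real, Real.norm_of_nonneg hε.le, heatKernel]

theorem ENNReal.two_mul_mul_le_sq_add_sq (a b : ℝ≥0∞) : 2 * (a * b) ≤ a ^ 2 + b ^ 2 := by
  rcases eq_or_ne a ∞ with rfl | ha
  · simp
  rcases eq_or_ne b ∞ with rfl | hb
  · simp
  lift a to ℝ≥0 using ha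
  lift b to ℝ≥0 using hb
  have := two_mul_le_add_sq (a : ℝ) b
  norm_cast
  rw [← NNReal.coe_le_coe]
  push_cast
  linarith

/-- Convolution with an even kernel of integral `1` is a contraction of `L²`, in weak form. -/
theorem lintegral_mul_lintegral_even_kernel_mul_le {k : V → ℝ≥0∞} (hk : Measurable k)
    (hsymm : ∀ x, k (-x) = k x) (hk1 : ∫⁻ x, k x = 1) {a : V → ℝ≥0∞} (ha : AEMeasurable a) :
    ∫⁻ x, a x * ∫⁻ y, k (x - y) * a y ≤ ∫⁻ x, a x ^ 2 := by
  have hkm : Measurable fun p : V × V => k (p.1 - p.2) :=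
    hk.comp (measurable_fst.sub measurable_snd)
  have hkx : ∀ x : V, Measurable fun y : V => k (x - y) :=
    fun x => hk.comp (measurable_const.sub measurable_id)
  have ha1 : AEMeasurable (fun p : V × V => a p.1) (volume.prod volume) :=
    ha.comp_quasiMeasurePreserving Measure.quasiMeasurePreserving_fst
  have ha2 : AEMeasurable (fun p : V × V => a p.2) (volume.prod volume) :=
    ha.comp_quasiMeasurePreserving Measure.quasiMeasurePreserving_snd
  have h1 : ∫⁻ x, ∫⁻ y, k (x - y) * a x ^ 2 = ∫⁻ x, a x ^ 2 := by
    refine lintegral_congr fun x => ?_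
    rw [lintegral_mul_const _ (hkx x), lintegral_sub_left_eq_self k x, hk1, one_mul]
  have h2 : ∫⁻ x, ∫⁻ y, k (x - y) * a y ^ 2 = ∫⁻ x, a x ^ 2 := by
    rw [lintegral_lintegral_swap (hkm.aemeasurable.mul (ha2.pow_const 2)), ← h1]
    refine lintegral_congr fun y => lintegral_congr fun x => ?_
    rw [← hsymm, neg_sub]
  -- Schur's test in its symmetric form: `2ab ≤ a² + b²`, after which each square integrates against
  -- a kernel of mass one.
  have hpt : ∀ x, 2 * (a x * ∫⁻ y, k (x - y) * a y) ≤
      (∫⁻ y, k (x - y) * a x ^ 2) + ∫⁻ y, k (x - y) * a y ^ 2 := by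
    intro x
    have hm : AEMeasurable fun y => k (x - y) * a y := (hkx x).aemeasurable.mul ha
    rw [← lintegral_add_left ((hkx x).mul_const _), ← mul_assoc, ← lintegral_const_mul'' _ hm]
    refine lintegral_mono fun y => ?_
    rw [← mul_add]
    refine le_trans (le_of_eq ?_)
      (mul_le_mul_right (ENNReal.two_mul_mul_le_sq_add_sq (a x) (a y)) (k (x - y)))
    ring
  have key : 2 * ∫⁻ x, a x * ∫⁻ y, k (x - y) * a y ≤ 2 * ∫⁻ x, a x ^ 2 := by
    rw [← lintegral_const_mul' _ _ ENNReal.ofNat_ne_top]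
    refine (lintegral_mono hpt).trans (le_of_eq ?_)
    have hm1 : AEMeasurable fun x => ∫⁻ y, k (x - y) * a x ^ 2 :=
      (hkm.aemeasurable.mul (ha1.pow_const 2)).lintegral_prod_right'
    rw [lintegral_add_left' hm1, h1, h2, two_mul]
  exact (ENNReal.mul_le_mul_iff_right two_ne_zero ENNReal.ofNat_ne_top).1 key

/-- Expand one factor, the conjugate of `𝓕 f`, as an integral and apply Fubini; the Gaussian weight
makes the double integral absolutely convergent for merely integrable `f`. -/
theorem integral_norm_sq_fourier_mul_gaussian {ε : ℝ} (hε : 0 < ε) {f : V → ℂ}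
    (hf : Integrable f) :
    ((∫ ξ : V, ‖𝓕 f ξ‖ ^ 2 * Real.exp (-(Real.pi * ε) * ‖ξ‖ ^ 2) : ℝ) : ℂ) =
      ∫ x, starRingEnd ℂ (f x) * gaussianConv (ε : ℂ) f x := by
  have hFc := Real.continuous_fourier_of_integrable hf
  set g : V → ℂ := fun ξ => ((Real.exp (-(Real.pi * ε) * ‖ξ‖ ^ 2) : ℝ) : ℂ) * 𝓕 f ξ with hg
  have hgi : Integrable g := by
    refine Integrable.mul_bdd (c := ∫ y, ‖f y‖) ?_ hFc.aestronglyMeasurable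
      (Eventually.of_forall (norm_fourier_le_integral_norm f))
    exact (integrable_rexp_neg_mul_sq_norm (V := V) (mul_pos Real.pi_pos hε)).ofReal
  have hint : Integrable (Function.uncurry fun (ξ x : V) =>
      (g ξ * starRingEnd ℂ (f x)) * (Real.fourierChar (inner ℝ x ξ) : ℂ)) (volume.prod volume) := by
    have hfc : Integrable fun x => starRingEnd ℂ (f x) :=
      hf.norm.mono' (Complex.continuous_conj.comp_aestronglyMeasurable hf.aestronglyMeasurable)
        (Eventually.of_forall fun x => (RCLike.norm_conj _).le)
    exact (hgi.mul_prod hfc).mul_bdd (c := 1)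
      (f := fun p : V × V => (g p.1 * starRingEnd ℂ (f p.2)))
      (g := fun p : V × V => (Real.fourierChar (inner ℝ p.2 p.1) : ℂ))
      (Continuous.aestronglyMeasurable (by fun_prop))
      (Eventually.of_forall fun p => (Circle.norm_coe _).le)
  have hswap := integral_integral_swap hint
  rw [← integral_complex_ofReal]
  calc _ = ∫ ξ, ∫ x, (g ξ * starRingEnd ℂ (f x)) * (Real.fourierChar (inner ℝ x ξ) : ℂ) := by
        refine integral_congr_ae (Eventually.of_forall fun ξ => ?_)
        have hconj : starRingEnd ℂ (𝓕 f ξ) =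
            ∫ x, starRingEnd ℂ (f x) * (Real.fourierChar (inner ℝ x ξ) : ℂ) := by
          rw [Real.fourier_eq, ← integral_conj]
          refine integral_congr_ae (Eventually.of_forall fun x => ?_)
          simp only [Circle.smul_def, smul_eq_mul, map_mul, ← Circle.coe_inv_eq_conj,
            ← AddChar.map_neg_eq_inv, neg_neg]
          ring
        simp only [mul_assoc]
        rw [integral_const_mul, ← hconj, hg]
        simp only
        rw [mul_assoc, Complex.mul_conj, Complex.normSq_eq_norm_sq]
        push_cast
        ring
    _ = ∫ x, ∫ ξ, (g ξ * starRingEnd ℂ (f x)) * (Real.fourierChar (inner ℝ x ξ) : ℂ) := hswap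
    _ = _ := by
        refine integral_congr_ae (Eventually.of_forall fun x => ?_)
        simp only
        rw [← integral_gaussian_mul_fourier (by simpa using hε) hf, ← integral_const_mul]
        refine integral_congr_ae (Eventually.of_forall fun ξ => ?_)
        simp only [hg]
        rw [Complex.exp_add, Real.fourierChar_apply]
        push_cast
        ring_nf

/-- Plancherel's inequality for integrable functions. -/
theorem lintegral_enorm_fourier_sq_le {f : V → ℂ} (hf : Integrable f) :
    ∫⁻ ξ, ‖𝓕 f ξ‖ₑ ^ 2 ≤ ∫⁻ x, ‖f x‖ₑ ^ 2 := by
  have hFc := Real.continuous_fourier_of_integrable hf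
  have hε : ∀ n : ℕ, (0 : ℝ) < 1 / ((n : ℝ) + 1) := fun n => by positivity
  -- Gaussian weights with `ε = 1/(n+1)`: each weighted integral is bounded by the heat contraction,
  -- and Fatou's lemma removes the weight.
  set F : ℕ → V → ℝ≥0∞ := fun n ξ => ENNReal.ofReal (‖𝓕 f ξ‖ ^ 2 *
    Real.exp (-(Real.pi * (1 / ((n : ℝ) + 1))) * ‖ξ‖ ^ 2)) with hF
  have hbound : ∀ n, ∫⁻ ξ, F n ξ ≤ ∫⁻ x, ‖f x‖ₑ ^ 2 := by
    intro n
    have hi : Integrable fun ξ => ‖𝓕 f ξ‖ ^ 2 *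
        Real.exp (-(Real.pi * (1 / ((n : ℝ) + 1))) * ‖ξ‖ ^ 2) := by
      refine (integrable_rexp_neg_mul_sq_norm (V := V) (mul_pos Real.pi_pos (hε n))).bdd_mul
        (c := (∫ y, ‖f y‖) ^ 2) (hFc.norm.pow 2).aestronglyMeasurable
        (Eventually.of_forall fun ξ => ?_)
      rw [norm_pow, norm_norm]
      gcongr
      exact norm_fourier_le_integral_norm f ξ
    rw [hF, ← ofReal_integral_eq_lintegral_ofReal hi (Eventually.of_forall fun ξ => by positivity)]
    have hnn : 0 ≤ ∫ ξ, ‖𝓕 f ξ‖ ^ 2 *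
        Real.exp (-(Real.pi * (1 / ((n : ℝ) + 1))) * ‖ξ‖ ^ 2) :=
      integral_nonneg fun ξ => by positivity
    rw [← Real.norm_of_nonneg hnn, ← Complex.norm_real,
      integral_norm_sq_fourier_mul_gaussian (hε n) hf, ofReal_norm]
    refine (enorm_integral_le_lintegral_enorm _).trans ?_
    refine le_trans ?_ (lintegral_mul_lintegral_even_kernel_mul_le
      (k := fun x : V => ENNReal.ofReal (heatKernel (1 / ((n : ℝ) + 1)) x))
      (ENNReal.measurable_ofReal.comp (continuous_heatKernel _).measurable)
      (fun x => by simp only [heatKernel, norm_neg]) (lintegral_heatKernel (hε n))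
      hf.aestronglyMeasurable.enorm)
    refine lintegral_mono fun x => ?_
    rw [enorm_mul, ← ofReal_norm, RCLike.norm_conj, ofReal_norm]
    gcongr
    exact enorm_gaussianConv_ofReal_le (hε n) f x
  have hlim : ∀ ξ, Tendsto (fun n => F n ξ) atTop (𝓝 (‖𝓕 f ξ‖ₑ ^ 2)) := by
    intro ξ
    have h0 := tendsto_one_div_add_atTop_nhds_zero_nat (𝕜 := ℝ)
    have h1 : Continuous fun t : ℝ => ENNReal.ofReal (‖𝓕 f ξ‖ ^ 2 *
      Real.exp (-(Real.pi * t) * ‖ξ‖ ^ 2)) := ENNReal.continuous_ofReal.comp (by fun_prop)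
    have h2 := (h1.tendsto 0).comp h0
    simp only [mul_zero, neg_zero, zero_mul, Real.exp_zero, mul_one] at h2
    rwa [ENNReal.ofReal_pow (norm_nonneg _), ofReal_norm] at h2
  have hmeas : ∀ n, Measurable (F n) := fun n =>
    (ENNReal.continuous_ofReal.comp (by fun_prop)).measurable
  calc ∫⁻ ξ, ‖𝓕 f ξ‖ₑ ^ 2 = ∫⁻ ξ, liminf (fun n => F n ξ) atTop :=
        lintegral_congr fun ξ => (hlim ξ).liminf_eq.symm
    _ ≤ liminf (fun n => ∫⁻ ξ, F n ξ) atTop := lintegral_liminf_le hmeas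
    _ ≤ liminf (fun _ : ℕ => ∫⁻ x, ‖f x‖ₑ ^ 2) atTop :=
        liminf_le_liminf (Eventually.of_forall hbound)
    _ = _ := liminf_const _

end HausdorffYoung

/-! ### Hausdorff-Young by real interpolation -/

section HausdorffYoung

variable {V : Type*} [NormedAddCommGroup V] [InnerProductSpace ℝ V] [FiniteDimensional ℝ V]
  [MeasurableSpace V] [BorelSpace V]

open Filter Topology

theorem ofReal_norm_rpow (w : ℂ) {r : ℝ} (hr : 0 ≤ r) : ENNReal.ofReal (‖w‖ ^ r) = ‖w‖ₑ ^ r := by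
  rw [← ENNReal.ofReal_rpow_of_nonneg (norm_nonneg _) hr, ofReal_norm]

theorem setLIntegral_Ioc_rpow {r L : ℝ} (hr : -1 < r) (hL : 0 ≤ L) :
    ∫⁻ t in Set.Ioc 0 L, ENNReal.ofReal (t ^ r) = ENNReal.ofReal (L ^ (r + 1) / (r + 1)) := by
  rw [← ofReal_integral_eq_lintegral_ofReal
      ((intervalIntegrable_iff_integrableOn_Ioc_of_le hL).1
        (intervalIntegral.intervalIntegrable_rpow' hr))
      ((ae_restrict_iff' measurableSet_Ioc).2 (Eventually.of_forall fun t ht =>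
        Real.rpow_nonneg ht.1.le _)),
    ← intervalIntegral.integral_of_le hL, integral_rpow (Or.inl hr),
    Real.zero_rpow (by linarith), sub_zero]

/-- Marcinkiewicz splitting at a height depending on `t`. Where `t|f|^(P-1) > 2N` one has `|f| ≤
(t/2N)|f|^P`, so this part has `L¹` norm at most `t/2` and cannot account for the level `t`. The
bounded part must exceed `t/2`, which Chebyshev and Plancherel control. -/
theorem volume_lt_norm_fourier_le {P N t : ℝ} (hP : 1 < P) (hN : 0 < N) (ht : 0 < t) {f : V → ℂ}
    (hf : Integrable f) (hfm : Measurable f) (hfN : ∫⁻ x, ‖f x‖ₑ ^ P ≤ ENNReal.ofReal N) :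
    volume {ξ | t < ‖𝓕 f ξ‖} ≤ ENNReal.ofReal (4 / t ^ 2) *
      ∫⁻ x, {x | t * ‖f x‖ ^ (P - 1) ≤ 2 * N}.indicator (fun x => ‖f x‖ₑ ^ 2) x := by
  set B : Set V := {x | t * ‖f x‖ ^ (P - 1) ≤ 2 * N} with hB
  have hBm : MeasurableSet B :=
    measurableSet_le (measurable_const.mul (hfm.norm.pow_const _)) measurable_const
  have hlow := hf.indicator hBm
  have hhigh := hf.indicator hBm.compl
  have hhighb : ∫ x, ‖Bᶜ.indicator f x‖ ≤ t / 2 := by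
    rw [integral_norm_eq_lintegral_enorm hhigh.aestronglyMeasurable]
    refine ENNReal.toReal_le_of_le_ofReal (by positivity) ?_
    calc ∫⁻ x, ‖Bᶜ.indicator f x‖ₑ ≤ ∫⁻ x, ENNReal.ofReal (t / (2 * N)) * ‖f x‖ₑ ^ P := by
          refine lintegral_mono fun x => ?_
          by_cases hx : x ∈ B
          · rw [Set.indicator_of_notMem (by simpa using hx)]; simp
          · rw [Set.indicator_of_mem (by simpa using hx), ← ofReal_norm_rpow _ (by linarith),
              ← ofReal_norm, ← ENNReal.ofReal_mul (by positivity)]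
            refine ENNReal.ofReal_le_ofReal ?_
            have hx' : 2 * N < t * ‖f x‖ ^ (P - 1) := by
              simpa only [hB, Set.mem_ofPred_eq, not_le] using hx
            have h0 : 0 < ‖f x‖ := by
              rcases (norm_nonneg (f x)).eq_or_lt with h | h
              · rw [← h, Real.zero_rpow (by linarith), mul_zero] at hx'
                linarith
              · exact h
            have hs : ‖f x‖ ^ P = ‖f x‖ ^ (P - 1) * ‖f x‖ := by
              conv_rhs => rw [← Real.rpow_one ‖f x‖, ← Real.rpow_mul h0.le, one_mul,
                ← Real.rpow_add h0]
              congr 1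
              ring
            rw [hs, ← mul_assoc]
            refine le_mul_of_one_le_left h0.le ?_
            rw [div_mul_eq_mul_div, one_le_div (by positivity)]
            exact hx'.le
      _ ≤ ENNReal.ofReal (t / 2) := by
          rw [lintegral_const_mul' _ _ ENNReal.ofReal_ne_top]
          refine (mul_le_mul_right hfN _).trans (le_of_eq ?_)
          rw [← ENNReal.ofReal_mul (by positivity)]
          congr 1
          field_simp
  have hsum : ∀ ξ, 𝓕 f ξ = 𝓕 (B.indicator f) ξ + 𝓕 (Bᶜ.indicator f) ξ := by
    intro ξ
    have h := VectorFourier.fourierIntegral_add (μ := (volume : Measure V)) (L := innerₗ V)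
      Real.continuous_fourierChar continuous_inner hlow hhigh
    rw [Set.indicator_self_add_compl] at h
    exact congrFun h ξ
  have hsub : {ξ | t < ‖𝓕 f ξ‖} ⊆
      {ξ | ENNReal.ofReal ((t / 2) ^ 2) ≤ ‖𝓕 (B.indicator f) ξ‖ₑ ^ 2} := by
    intro ξ hξ
    simp only [Set.mem_ofPred_eq] at hξ ⊢
    rw [← ofReal_norm, ← ENNReal.ofReal_pow (norm_nonneg _)]
    refine ENNReal.ofReal_le_ofReal ?_
    have h1 := norm_add_le (𝓕 (B.indicator f) ξ) (𝓕 (Bᶜ.indicator f) ξ)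
    rw [← hsum] at h1
    have h2 := (norm_fourier_le_integral_norm (Bᶜ.indicator f) ξ).trans hhighb
    gcongr
    linarith
  have hcheb := mul_meas_ge_le_lintegral₀ (μ := (volume : Measure V))
    (f := fun ξ => ‖𝓕 (B.indicator f) ξ‖ₑ ^ 2)
    ((Real.continuous_fourier_of_integrable hlow).enorm.measurable.pow_const 2).aemeasurable
    (ENNReal.ofReal ((t / 2) ^ 2))
  have hpl := lintegral_enorm_fourier_sq_le hlow
  have heq : ∫⁻ x, ‖B.indicator f x‖ₑ ^ 2 = ∫⁻ x, B.indicator (fun x => ‖f x‖ₑ ^ 2) x := by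
    refine lintegral_congr fun x => ?_
    by_cases hx : x ∈ B
    · simp only [Set.indicator_of_mem hx]
    · simp [Set.indicator_of_notMem hx]
  rw [← heq]
  calc volume {ξ | t < ‖𝓕 f ξ‖}
      ≤ volume {ξ | ENNReal.ofReal ((t / 2) ^ 2) ≤ ‖𝓕 (B.indicator f) ξ‖ₑ ^ 2} :=
        measure_mono hsub
    _ = ENNReal.ofReal (4 / t ^ 2) * (ENNReal.ofReal ((t / 2) ^ 2) *
          volume {ξ | ENNReal.ofReal ((t / 2) ^ 2) ≤ ‖𝓕 (B.indicator f) ξ‖ₑ ^ 2}) := by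
        rw [← mul_assoc, ← ENNReal.ofReal_mul (by positivity)]
        have : 4 / t ^ 2 * (t / 2) ^ 2 = 1 := by field_simp; norm_num
        rw [this, ENNReal.ofReal_one, one_mul]
    _ ≤ _ := by
        gcongr
        exact hcheb.trans hpl

/-- This is the integral over levels at one point `x`, with `w = f x`. `Q > 2` makes `t^(Q-3)`
integrable at `0`, and conjugacy gives `2 - (P-1)(Q-2) = P`. -/
theorem lintegral_Ioi_indicator_le {P Q N : ℝ} (hPQ : P.HolderConjugate Q) (hQ : 2 < Q)
    (hN : 0 < N) (w : ℂ) :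
    ∫⁻ t in Set.Ioi (0 : ℝ), ENNReal.ofReal (4 * t ^ (Q - 3)) *
      {t : ℝ | t * ‖w‖ ^ (P - 1) ≤ 2 * N}.indicator (fun _ => ‖w‖ₑ ^ 2) t ≤
      ENNReal.ofReal (4 * (2 * N) ^ (Q - 2) / (Q - 2)) * ‖w‖ₑ ^ P := by
  rcases eq_or_ne w 0 with rfl | hw
  · refine le_of_eq_of_le ?_ zero_le
    simp
  have hA : 0 < ‖w‖ := norm_pos_iff.2 hw
  have hAp : 0 < ‖w‖ ^ (P - 1) := Real.rpow_pos_of_pos hA _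
  refine le_of_eq ?_
  set L : ℝ := 2 * N / ‖w‖ ^ (P - 1) with hL
  have hL0 : 0 < L := by positivity
  calc _ = ∫⁻ t in Set.Ioc (0 : ℝ) L, ENNReal.ofReal (4 * t ^ (Q - 3)) * ‖w‖ₑ ^ 2 := by
        rw [← lintegral_indicator measurableSet_Ioi, ← lintegral_indicator measurableSet_Ioc]
        refine lintegral_congr fun t => ?_
        have hiff : t ∈ {t : ℝ | t * ‖w‖ ^ (P - 1) ≤ 2 * N} ↔ t ≤ L := by
          rw [Set.mem_ofPred_eq, hL, le_div_iff₀ hAp]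
        by_cases h0 : 0 < t
        · rw [Set.indicator_of_mem (Set.mem_Ioi.2 h0)]
          by_cases h1 : t ≤ L
          · rw [Set.indicator_of_mem (hiff.2 h1), Set.indicator_of_mem (Set.mem_Ioc.2 ⟨h0, h1⟩)]
          · rw [Set.indicator_of_notMem (fun h => h1 (hiff.1 h)),
              Set.indicator_of_notMem (fun h => h1 (Set.mem_Ioc.1 h).2), mul_zero]
        · rw [Set.indicator_of_notMem (fun h => h0 (Set.mem_Ioi.1 h)),
            Set.indicator_of_notMem (fun h => h0 (Set.mem_Ioc.1 h).1)]
    _ = ENNReal.ofReal 4 * ENNReal.ofReal (L ^ (Q - 2) / (Q - 2)) * ‖w‖ₑ ^ 2 := by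
        rw [lintegral_mul_const' _ _ (by simp)]
        congr 1
        simp_rw [ENNReal.ofReal_mul (by norm_num : (0 : ℝ) ≤ 4)]
        rw [lintegral_const_mul' _ _ ENNReal.ofReal_ne_top,
          setLIntegral_Ioc_rpow (by linarith) hL0.le]
        congr 3 <;> ring_nf
    _ = _ := by
        rw [← ofReal_norm_rpow _ hPQ.pos.le, ← ofReal_norm, ← ENNReal.ofReal_pow (norm_nonneg _),
          ← ENNReal.ofReal_mul (by norm_num), ← ENNReal.ofReal_mul
            (mul_nonneg (by norm_num) (div_nonneg (by positivity) (by linarith))),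
          ← ENNReal.ofReal_mul (div_nonneg (by positivity) (by linarith))]
        congr 1
        have h1 : L ^ (Q - 2) = (2 * N) ^ (Q - 2) * ‖w‖ ^ (-((P - 1) * (Q - 2))) := by
          rw [hL, Real.div_rpow (by positivity) hAp.le, ← Real.rpow_mul hA.le, Real.rpow_neg hA.le,
            div_eq_mul_inv]
        have h2 : ‖w‖ ^ (-((P - 1) * (Q - 2))) * ‖w‖ ^ 2 = ‖w‖ ^ P := by
          rw [← Real.rpow_natCast ‖w‖ 2, ← Real.rpow_add hA]
          congr 1
          push_cast
          linarith [hPQ.mul_eq_add]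
        rw [h1, ← h2]
        ring

/-- The Hausdorff-Young inequality, with a non-optimal constant, for measurable functions. -/
theorem lintegral_enorm_fourier_rpow_le {P Q N : ℝ} (hPQ : P.HolderConjugate Q) (hQ : 2 < Q)
    (hN : 0 < N) {f : V → ℂ} (hf : Integrable f) (hfm : Measurable f)
    (hfN : ∫⁻ x, ‖f x‖ₑ ^ P ≤ ENNReal.ofReal N) :
    ∫⁻ ξ, ‖𝓕 f ξ‖ₑ ^ Q ≤ ENNReal.ofReal (Q * 4 * 2 ^ (Q - 2) / (Q - 2)) *
      ENNReal.ofReal (N ^ (Q - 1)) := by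
  have hQ0 : 0 < Q := hPQ.symm.pos
  have hFc := Real.continuous_fourier_of_integrable hf
  have hlayer := lintegral_rpow_eq_lintegral_meas_lt_mul (volume : Measure V)
    (f := fun ξ => ‖𝓕 f ξ‖) (Eventually.of_forall fun ξ => norm_nonneg _)
    hFc.norm.measurable.aemeasurable hQ0
  simp_rw [ofReal_norm_rpow _ hQ0.le] at hlayer
  rw [hlayer]
  have hjoint : Measurable (Function.uncurry fun (t : ℝ) (x : V) =>
      ENNReal.ofReal (4 * t ^ (Q - 3)) *
        {x | t * ‖f x‖ ^ (P - 1) ≤ 2 * N}.indicator (fun x => ‖f x‖ₑ ^ 2) x) := by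
    have hset : MeasurableSet {p : ℝ × V | p.1 * ‖f p.2‖ ^ (P - 1) ≤ 2 * N} :=
      measurableSet_le (measurable_fst.mul ((hfm.comp measurable_snd).norm.pow_const _))
        measurable_const
    have h2 : Measurable fun p : ℝ × V => {p : ℝ × V | p.1 * ‖f p.2‖ ^ (P - 1) ≤ 2 * N}.indicator
        (fun p => ‖f p.2‖ₑ ^ 2) p :=
      ((hfm.comp measurable_snd).enorm.pow_const 2).indicator hset
    exact (ENNReal.measurable_ofReal.comp
      (measurable_const.mul (measurable_fst.pow_const _))).mul h2
  calc _ ≤ ENNReal.ofReal Q * ∫⁻ t in Set.Ioi (0 : ℝ), ∫⁻ x, ENNReal.ofReal (4 * t ^ (Q - 3)) *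
        {x | t * ‖f x‖ ^ (P - 1) ≤ 2 * N}.indicator (fun x => ‖f x‖ₑ ^ 2) x := by
        refine mul_le_mul_right (setLIntegral_mono' measurableSet_Ioi fun t ht => ?_) _
        have ht0 : 0 < t := ht
        rw [lintegral_const_mul' _ _ ENNReal.ofReal_ne_top]
        refine (mul_le_mul_left (volume_lt_norm_fourier_le hPQ.lt hN ht0 hf hfm hfN) _).trans
          (le_of_eq ?_)
        rw [mul_right_comm, ← ENNReal.ofReal_mul (by positivity)]
        congr 2
        rw [div_mul_eq_mul_div, mul_div_assoc, ← Real.rpow_natCast t 2, ← Real.rpow_sub ht0]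
        congr 2
        push_cast
        ring
    _ = ENNReal.ofReal Q * ∫⁻ x, ∫⁻ t in Set.Ioi (0 : ℝ), ENNReal.ofReal (4 * t ^ (Q - 3)) *
        {x | t * ‖f x‖ ^ (P - 1) ≤ 2 * N}.indicator (fun x => ‖f x‖ₑ ^ 2) x := by
        rw [lintegral_lintegral_swap hjoint.aemeasurable]
    _ ≤ ENNReal.ofReal Q * ∫⁻ x, ENNReal.ofReal (4 * (2 * N) ^ (Q - 2) / (Q - 2)) * ‖f x‖ₑ ^ P := by
        refine mul_le_mul_right (lintegral_mono fun x => ?_) _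
        exact lintegral_Ioi_indicator_le hPQ hQ hN (f x)
    _ ≤ ENNReal.ofReal Q * (ENNReal.ofReal (4 * (2 * N) ^ (Q - 2) / (Q - 2)) *
          ENNReal.ofReal N) := by
        rw [lintegral_const_mul' _ _ ENNReal.ofReal_ne_top]
        gcongr
    _ = _ := by
        have hQ2 : 0 < Q - 2 := by linarith
        rw [← ENNReal.ofReal_mul (by positivity), ← ENNReal.ofReal_mul hQ0.le,
          ← ENNReal.ofReal_mul (by positivity)]
        congr 1
        rw [Real.mul_rpow two_pos.le hN.le]
        have : N ^ (Q - 1) = N ^ (Q - 2) * N := by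
          conv_rhs => rw [← Real.rpow_one N, ← Real.rpow_mul hN.le, one_mul, ← Real.rpow_add hN]
          congr 1
          ring
        rw [this]
        ring

/-- The Hausdorff-Young inequality, with a non-optimal constant, for integrable functions. -/
theorem exists_eLpNorm_fourier_le {p q : ℝ≥0∞} (hpq : p.HolderConjugate q) (hp2 : p < 2) :
    ∃ C : ℝ≥0, ∀ f : V → ℂ, MemLp f 1 volume → MemLp f p volume →
      eLpNorm (𝓕 f) q volume ≤ C * eLpNorm f p volume := by
  have hp1 : 1 ≤ p := ENNReal.HolderConjugate.one_le p q
  have hptop : p ≠ ∞ := (hp2.trans ENNReal.ofNat_lt_top).ne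
  -- The endpoint `p = 1`, `q = ∞` is the trivial sup bound; interpolation covers `1 < p < 2`.
  rcases hp1.eq_or_lt with rfl | hp1
  · have hq : q = ∞ := by
      have := hpq.inv_add_inv_eq_inv
      simpa using this
    subst hq
    refine ⟨1, fun f hf _ => ?_⟩
    rw [eLpNorm_exponent_top, eLpNorm_one_eq_lintegral_enorm, ENNReal.coe_one, one_mul]
    refine eLpNormEssSup_le_of_ae_enorm_bound (Eventually.of_forall fun ξ => ?_)
    rw [Real.fourier_eq]
    refine (enorm_integral_le_lintegral_enorm _).trans (lintegral_mono fun x => le_of_eq ?_)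
    rw [← ofReal_norm, ← ofReal_norm, Circle.norm_smul]
  · have hP1 : 1 < p.toReal := by
      rw [← ENNReal.toReal_one]
      exact (ENNReal.toReal_lt_toReal ENNReal.one_ne_top hptop).2 hp1
    have hP2 : p.toReal < 2 := by
      have := (ENNReal.toReal_lt_toReal hptop ENNReal.ofNat_ne_top).2 hp2
      simpa using this
    have hPQ : p.toReal.HolderConjugate q.toReal := ENNReal.HolderConjugate.toReal hP1
    have hq0 : q ≠ 0 := by rintro rfl; simpa using hPQ.symm.pos
    have hqtop : q ≠ ∞ := by rintro rfl; simpa using hPQ.symm.pos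
    have hQ2 : 2 < q.toReal := by
      have := hPQ.mul_eq_add
      have := hPQ.symm.pos
      nlinarith
    set c : ℝ := q.toReal * 4 * 2 ^ (q.toReal - 2) / (q.toReal - 2) with hc
    refine ⟨(ENNReal.ofReal c ^ (1 / q.toReal)).toNNReal, fun f hf1 hfp => ?_⟩
    obtain ⟨g, hgm, hfg⟩ := hf1.aestronglyMeasurable
    have hFfg : 𝓕 f = 𝓕 g := funext (Real.fourier_congr_ae hfg)
    rw [hFfg, eLpNorm_congr_ae hfg]
    replace hf1 := (memLp_congr_ae hfg).1 hf1
    replace hfp := (memLp_congr_ae hfg).1 hfp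
    have hp0 : p ≠ 0 := (zero_lt_one.trans hp1).ne'
    have hfin := lintegral_rpow_enorm_lt_top_of_eLpNorm_lt_top hp0 hptop hfp.2
    rw [ENNReal.coe_toNNReal (ENNReal.rpow_ne_top_of_nonneg (by positivity) ENNReal.ofReal_ne_top)]
    -- The splitting height needs `N > 0`. With `N = ‖g‖_p^p` the bound `N^(Q-1)` has `Q`-th root
    -- `N^(1/P) = ‖g‖_p`.
    rcases eq_or_ne (∫⁻ x, ‖g x‖ₑ ^ p.toReal) 0 with hI | hI
    · have hg0 : g =ᵐ[volume] 0 := by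
        rw [← eLpNorm_eq_zero_iff hgm.aestronglyMeasurable hp0,
          eLpNorm_eq_lintegral_rpow_enorm_toReal hp0 hptop, hI,
          ENNReal.zero_rpow_of_pos (by positivity)]
      have : 𝓕 g = 0 := by
        ext ξ
        rw [Real.fourier_congr_ae hg0 ξ]
        simp [Real.fourier_eq]
      rw [this, eLpNorm_zero]
      exact zero_le
    · have hN := ENNReal.toReal_pos hI hfin.ne
      have hNeq := ENNReal.ofReal_toReal hfin.ne
      have key := lintegral_enorm_fourier_rpow_le hPQ hQ2 hN (memLp_one_iff_integrable.1 hf1)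
        hgm.measurable hNeq.ge
      rw [eLpNorm_eq_lintegral_rpow_enorm_toReal hq0 hqtop,
        eLpNorm_eq_lintegral_rpow_enorm_toReal hp0 hptop]
      refine (ENNReal.rpow_le_rpow key (by positivity)).trans (le_of_eq ?_)
      rw [ENNReal.mul_rpow_of_nonneg _ _ (by positivity),
        ← ENNReal.ofReal_rpow_of_pos hN, hNeq, ← ENNReal.rpow_mul]
      congr 2
      have := hPQ.mul_eq_add
      have h1 := hPQ.pos
      have h2 := hPQ.symm.pos
      field_simp
      linarith

end HausdorffYoung

/-! ### Dispersive estimate and summation over times -/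

section Dispersive

variable {V : Type*} [NormedAddCommGroup V] [InnerProductSpace ℝ V] [FiniteDimensional ℝ V]
  [MeasurableSpace V] [BorelSpace V]

open Filter Topology

/-- The function `f` multiplied by the chirp `exp (i π |y|² / s)`. -/
noncomputable def chirpMul (s : ℝ) (f : V → ℂ) (y : V) : ℂ :=
  Complex.exp ((Real.pi * ‖y‖ ^ 2 / s : ℝ) * Complex.I) * f y

theorem norm_chirpMul (s : ℝ) (f : V → ℂ) (y : V) : ‖chirpMul s f y‖ = ‖f y‖ := by
  rw [chirpMul, norm_mul, Complex.norm_exp_ofReal_mul_I, one_mul]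

theorem aestronglyMeasurable_chirpMul (s : ℝ) {f : V → ℂ} (hf : AEStronglyMeasurable f volume) :
    AEStronglyMeasurable (chirpMul s f) volume :=
  (Continuous.aestronglyMeasurable (by fun_prop)).mul hf

theorem memLp_chirpMul (s : ℝ) {f : V → ℂ} {p : ℝ≥0∞} (hf : MemLp f p volume) :
    MemLp (chirpMul s f) p volume :=
  hf.of_le (aestronglyMeasurable_chirpMul s hf.aestronglyMeasurable)
    (Eventually.of_forall fun y => (norm_chirpMul s f y).le)

/-- The Schrödinger flow is, up to chirps and a dilation, the Fourier transform. -/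
theorem norm_gaussianConv_mul_I {s : ℝ} (hs : s ≠ 0) (f : V → ℂ) (x : V) :
    ‖gaussianConv (s * Complex.I) f x‖ =
      |s| ^ (-(Module.finrank ℝ V / 2 : ℝ)) * ‖𝓕 (chirpMul s f) (s⁻¹ • x)‖ := by
  have hsC : (s : ℂ) ≠ 0 := by exact_mod_cast hs
  -- Expanding `|x - y|²`: the square terms are chirps and the cross term `-2πi x·y/s` is the
  -- Fourier phase at `x/s`.
  have h1 : ∫ y, Complex.exp (-Real.pi * ‖x - y‖ ^ 2 / (s * Complex.I)) * f y =
      Complex.exp ((Real.pi * ‖x‖ ^ 2 / s : ℝ) * Complex.I) * 𝓕 (chirpMul s f) (s⁻¹ • x) := by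
    rw [Real.fourier_eq, ← integral_const_mul]
    refine integral_congr_ae (Eventually.of_forall fun y => ?_)
    simp only [chirpMul, Circle.smul_def, smul_eq_mul, Real.fourierChar_apply]
    rw [← mul_assoc, ← mul_assoc, ← Complex.exp_add, ← Complex.exp_add]
    congr 2
    have hn : ((‖x - y‖ ^ 2 : ℝ) : ℂ) = (‖x‖ ^ 2 - 2 * inner ℝ x y + ‖y‖ ^ 2 : ℝ) := by
      rw [norm_sub_sq_real]
    rw [inner_smul_right, real_inner_comm]
    push_cast at hn ⊢
    rw [hn]
    field_simp
    ring_nf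
    simp only [Complex.I_sq]
    ring
  rw [gaussianConv, h1, norm_mul, norm_mul, Complex.norm_exp_ofReal_mul_I, one_mul,
    norm_one_div_cpow_half]
  simp

theorem eLpNorm_comp_inv_smul {g : V → ℂ} (hg : Continuous g) (q : ℝ≥0∞) {s : ℝ} (hs : s ≠ 0) :
    eLpNorm (fun x => g (s⁻¹ • x)) q volume =
      ENNReal.ofReal (|s| ^ (Module.finrank ℝ V * (1 / q).toReal)) * eLpNorm g q volume := by
  have h := Measure.map_addHaar_smul (volume : Measure V) (inv_ne_zero hs)
  have h1 : eLpNorm (fun x => g (s⁻¹ • x)) q volume =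
      eLpNorm g q (Measure.map (fun x => s⁻¹ • x) volume) :=
    (eLpNorm_map_measure hg.aestronglyMeasurable (measurable_const_smul _).aemeasurable).symm
  have hs0 : 0 < |s| := abs_pos.2 hs
  have h2 : |(s⁻¹ ^ Module.finrank ℝ V)⁻¹| = |s| ^ (Module.finrank ℝ V : ℝ) := by
    rw [inv_pow, inv_inv, abs_pow, Real.rpow_natCast]
  rw [h1, h, h2, eLpNorm_smul_measure_of_ne_zero (by
    rw [Ne, ENNReal.ofReal_eq_zero, not_le]; positivity), smul_eq_mul,
    ENNReal.ofReal_rpow_of_pos (by positivity), ← Real.rpow_mul hs0.le]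

/-- The dispersive estimate for the Schrödinger flow. -/
theorem exists_eLpNorm_gaussianConv_mul_I_le {p q : ℝ≥0∞} (hpq : p.HolderConjugate q)
    (hp2 : p < 2) :
    ∃ C : ℝ≥0, ∀ (s : ℝ) (f : V → ℂ), s ≠ 0 → MemLp f 1 volume → MemLp f p volume →
      eLpNorm (gaussianConv (s * Complex.I) f) q volume ≤
        ENNReal.ofReal (|s| ^
          (-(Module.finrank ℝ V / 2 - Module.finrank ℝ V * (1 / q).toReal : ℝ))) *
          (C * eLpNorm f p volume) := by
  obtain ⟨C, hC⟩ := exists_eLpNorm_fourier_le (V := V) hpq hp2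
  refine ⟨C, fun s f hs hf1 hfp => ?_⟩
  have hs0 : 0 < |s| := abs_pos.2 hs
  have hf1' := memLp_chirpMul s hf1
  have hcont := Real.continuous_fourier_of_integrable (memLp_one_iff_integrable.1 hf1')
  have h1 : eLpNorm (gaussianConv (s * Complex.I) f) q volume =
      eLpNorm ((|s| ^ (-(Module.finrank ℝ V / 2 : ℝ))) •
        fun x => 𝓕 (chirpMul s f) (s⁻¹ • x)) q volume := by
    refine eLpNorm_congr_norm_ae (Eventually.of_forall fun x => ?_)
    rw [norm_gaussianConv_mul_I hs, Pi.smul_apply, norm_smul, Real.norm_of_nonneg (by positivity)]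
  -- The dilation by `s` contributes `|s|^(d/q)` against the prefactor `|s|^(-d/2)`.
  rw [h1, eLpNorm_const_smul, eLpNorm_comp_inv_smul hcont q hs, ← mul_assoc,
    ← ofReal_norm, Real.norm_of_nonneg (by positivity), ← ENNReal.ofReal_mul (by positivity),
    ← Real.rpow_add hs0]
  have hchirp : eLpNorm (chirpMul s f) p volume = eLpNorm f p volume :=
    eLpNorm_congr_norm_ae (Eventually.of_forall (norm_chirpMul s f))
  rw [← hchirp]
  refine mul_le_mul' (le_of_eq ?_) (hC _ hf1' (memLp_chirpMul s hfp))
  congr 2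
  ring

/-- Boundedness of the sum of Schrödinger evolutions, in the range where the decay of the
dispersive estimate is summable. -/
theorem exists_eLpNorm_schrodingerSum_le (hV : 3 ≤ Module.finrank ℝ V) {p q : ℝ≥0∞}
    (hpq : p.HolderConjugate q) (hp2 : p < 2)
    (hdecay : 1 < (Module.finrank ℝ V / 2 - Module.finrank ℝ V * (1 / q).toReal : ℝ)) :
    ∃ C : ℝ≥0, ∀ f : V → ℂ, MemLp f 1 volume → MemLp f p volume →
      MemLp (schrodingerSum f) q volume ∧
        eLpNorm (schrodingerSum f) q volume ≤ C * eLpNorm f p volume := by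
  obtain ⟨C, hC⟩ := exists_eLpNorm_gaussianConv_mul_I_le (V := V) hpq hp2
  have : Fact (1 ≤ q) := ⟨have := hpq.symm; ENNReal.HolderConjugate.one_le q p⟩
  set e : ℝ := Module.finrank ℝ V / 2 - Module.finrank ℝ V * (1 / q).toReal with he
  have hsum := summable_abs_div_four_rpow hdecay
  set A : ℝ≥0∞ := ∑' k : ℤ, ENNReal.ofReal (|(k / 4 : ℝ)| ^ (-e)) with hA
  have hAtop : A ≠ ∞ := hsum.tsum_ofReal_ne_top
  refine ⟨A.toNNReal * C, fun f hf1 hfp => ?_⟩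
  have hf := memLp_one_iff_integrable.1 hf1
  set T : ℤ → V → ℂ := fun k x => gaussianConv ((k / 4 : ℝ) * Complex.I) f x *
    fourier k ((3 / 8 : ℝ) : UnitAddCircle) with hT
  have hTb : ∀ k, eLpNorm (T k) q volume ≤
      ENNReal.ofReal (|(k / 4 : ℝ)| ^ (-e)) * (C * eLpNorm f p volume) := by
    intro k
    rcases eq_or_ne k 0 with rfl | hk
    · have : T 0 = 0 := by
        ext x
        simp [hT, gaussianConv_zero (V := V) (by omega)]
      rw [this, eLpNorm_zero]
      exact zero_le
    · refine le_of_eq_of_le (eLpNorm_congr_norm_ae (Eventually.of_forall fun x => ?_))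
        (hC (k / 4) f (div_ne_zero (by exact_mod_cast hk) four_ne_zero) hf1 hfp)
      rw [hT, norm_mul_fourier_coe]
  have hTc : ∀ k, Continuous (T k) := fun k =>
    (continuous_gaussianConv (by simp) hf).mul continuous_const
  have hTm : ∀ k, MemLp (T k) q volume := fun k =>
    ⟨(hTc k).aestronglyMeasurable, (hTb k).trans_lt (ENNReal.mul_lt_top ENNReal.ofReal_lt_top
      (ENNReal.mul_lt_top ENNReal.coe_lt_top hfp.2))⟩
  have hnorm : ∑' k, ‖(hTm k).toLp (T k)‖ₑ ≤ A * (C * eLpNorm f p volume) := by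
    rw [hA, ← ENNReal.tsum_mul_right]
    refine ENNReal.tsum_le_tsum fun k => ?_
    rw [Lp.enorm_toLp]
    exact hTb k
  have hfin : A * (C * eLpNorm f p volume) ≠ ∞ :=
    ENNReal.mul_ne_top hAtop (ENNReal.mul_ne_top ENNReal.coe_ne_top hfp.2.ne)
  -- The series converges absolutely in `L^q`, and its `L^q` sum agrees almost everywhere with the
  -- pointwise sum.
  have hS : schrodingerSum f =ᵐ[volume] (∑' k, (hTm k).toLp (T k) : Lp ℂ q volume) := by
    filter_upwards [Lp.hasSum_coeFn_tsum (ne_top_of_le_ne_top hfin hnorm),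
      ae_all_iff.2 fun k => (hTm k).coeFn_toLp] with x hx hk
    rw [← hx.tsum_eq]
    exact tsum_congr fun k => (hk k).symm
  refine ⟨(memLp_congr_ae hS).2 (Lp.memLp _), ?_⟩
  rw [eLpNorm_congr_ae hS, ← Lp.enorm_def, ENNReal.coe_mul, ENNReal.coe_toNNReal hAtop, mul_assoc]
  exact enorm_tsum_le_tsum_enorm.trans hnorm

end Dispersive

/-! ### Lattice spheres, the exponent range, and the conclusion -/

theorem exists_latticePoint_norm_sq_eq {d : ℕ} (hd : 3 ≤ d) (j : ℕ) :
    ∃ m : Fin d → ℤ, ‖latticePoint m‖ ^ 2 = 8 * j + 3 := by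
  obtain ⟨n, rfl⟩ := Nat.exists_eq_add_of_le hd
  obtain ⟨x, y, z, h⟩ := Nat.exists_sum_three_squares_of_mod_eight_eq_three
    (m := 8 * j + 3) (by omega)
  refine ⟨Fin.append ![x, y, z] 0, ?_⟩
  rw [EuclideanSpace.norm_sq_eq]
  simp only [latticePoint, Real.norm_eq_abs, sq_abs]
  rw [Fin.sum_univ_add]
  simp only [Fin.append_left, Fin.append_right]
  simp only [Fin.sum_univ_three, Pi.zero_apply]
  simp
  exact_mod_cast h

/-- By conjugacy `d/2 - d/q = d(1/p - 1/2)`, so the threshold `2d/(d+2)` is exactly summability of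
the dispersive decay. -/
theorem one_lt_half_sub_mul_of_lt_div {d : ℕ} (hd : 3 ≤ d) {p q : ℝ≥0∞}
    (hp : p < 2 * (d : ℝ≥0∞) / ((d : ℝ≥0∞) + 2)) (hpq : p.HolderConjugate q) :
    1 < (d / 2 - d * (1 / q).toReal : ℝ) := by
  have hp1 : 1 ≤ p := ENNReal.HolderConjugate.one_le p q
  have hptop : p ≠ ∞ := hp.ne_top
  rw [ENNReal.lt_div_iff_mul_lt (Or.inl (by simp)) (Or.inl (by finiteness))] at hp
  have hP : p.toReal * (d + 2) < 2 * d := by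
    have := (ENNReal.toReal_lt_toReal (by finiteness) (by finiteness)).2 hp
    rw [ENNReal.toReal_mul, ENNReal.toReal_mul, ENNReal.toReal_add (by finiteness) (by finiteness)]
      at this
    simpa using this
  have hP1 : 1 ≤ p.toReal := by
    rw [← ENNReal.toReal_one]
    exact ENNReal.toReal_mono hptop hp1
  have hq : (1 / q).toReal = 1 - 1 / p.toReal := by
    have h := hpq.inv_add_inv_eq_inv
    have hq1 : 1 ≤ q := have := hpq.symm; ENNReal.HolderConjugate.one_le q p
    have := congrArg ENNReal.toReal h
    rw [ENNReal.toReal_add (ENNReal.inv_ne_top.2 (zero_lt_one.trans_le hp1).ne')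
      (ENNReal.inv_ne_top.2 (zero_lt_one.trans_le hq1).ne'), inv_one, ENNReal.toReal_one,
      ENNReal.toReal_inv p] at this
    rw [one_div, one_div]
    linarith
  have hd' : (3 : ℝ) ≤ d := by exact_mod_cast hd
  have hP0 : 0 < p.toReal := by linarith
  rw [hq]
  have : (d / 2 - d * (1 - 1 / p.toReal) : ℝ) - 1 =
      (2 * d - p.toReal * (d + 2)) / (2 * p.toReal) := by
    field_simp
    ring
  have h2 : 0 < (2 * d - p.toReal * (d + 2)) / (2 * p.toReal) := div_pos (by linarith) (by linarith)
  linarith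

theorem theorem1 (d : ℕ) (hd : 3 ≤ d) (p q : ℝ≥0∞) (hp1 : 1 ≤ p)
    (hp : p < 2 * (d : ℝ≥0∞) / ((d : ℝ≥0∞) + 2)) (hpq : p.HolderConjugate q) :
    ∃ C : ℝ≥0, ∀ f : EuclideanSpace ℝ (Fin d) → ℂ, MemLp f 1 volume → MemLp f p volume →
      (HasVanishingPeriodizations f ↔ FourierVanishesOnLatticeSpheres f) ∧
      (HasVanishingPeriodizations f →
        MemLp f q volume ∧ eLpNorm f q volume ≤ C * eLpNorm f p volume) := by
  have hfr : Module.finrank ℝ (EuclideanSpace ℝ (Fin d)) = d := finrank_euclideanSpace_fin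
  have hp2 : p < 2 := by
    refine hp.trans_le (ENNReal.div_le_of_le_mul ?_)
    gcongr
    exact le_self_add
  obtain ⟨C, hC⟩ := exists_eLpNorm_schrodingerSum_le (V := EuclideanSpace ℝ (Fin d))
    (hfr.symm ▸ hd) hpq hp2 (by rw [hfr]; exact one_lt_half_sub_mul_of_lt_div hd hp hpq)
  refine ⟨C, fun f hf1 hfp => ?_⟩
  have hf := memLp_one_iff_integrable.1 hf1
  have hiff := hasVanishingPeriodizations_iff (by omega) hf
  refine ⟨hiff, fun hvan => ?_⟩
  have hfS : f =ᵐ[volume] fun x => -schrodingerSum f x := by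
    refine ae_eq_neg_schrodingerSum (hfr.symm ▸ hd) hf fun j ξ hξ => ?_
    obtain ⟨m, hm⟩ := exists_latticePoint_norm_sq_eq hd j
    refine hiff.1 hvan m ξ ?_
    rw [mem_sphere_zero_iff_norm, ← sq_eq_sq₀ (norm_nonneg _) (norm_nonneg _), hξ, hm]
  obtain ⟨hm, hle⟩ := hC f hf1 hfp
  refine ⟨(memLp_congr_ae hfS).2 hm.neg, ?_⟩
  rw [eLpNorm_congr_ae hfS]
  refine le_of_eq_of_le ?_ hle
  exact eLpNorm_neg (schrodingerSum f) q volume
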